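/- **Setting.** Let $\Omega=[0,2\pi]^2$ with periodic boundary conditions, let $L^2_\sigma$ be the space of square-integrable, mean-free, divergence-free periodic vector fields with norm $\|u\|=(\int_\Omega|u|^2dx)^{1/2}$, and let $H^k_\sigma$ be the subspace of fields with square-integrable weak derivatives up to order $k$. Let $P$ be the Leray projection, $A=-P\Delta$ the Stokes operator, $A^{k/2}$ its powers (Fourier symbol $|\kappa|^{k}$, $\kappa\in\mathbb Z^2$), $B(u,v)=P(u\cdot\nabla)v$, $P_N$ the projection onto the wavenumbers $|\kappa|\le N$, and $Q_N=I-P_N$. Given $a\in\mathbb R$ and $F$, a strong solution on $[a,\infty)$ of $\frac{d}{dt}u+\nu Au+B(u,u)=F$ is a $u\in C([a,T];H^1_\sigma)\cap L^2(a,T;H^2_\sigma)$ with $\frac{d}{dt}u\in L^2(a,T;L^2_\sigma)$ for all $T>a$ that satisfies the equation in $L^2$ for a.e. $t$. Let $\nu,\mu>0$, $t_0\ge0$, $N\in\mathbb N$, and $f\in C([t_0,\infty);L^2_\sigma)\cap L^\infty(t_0,\infty;H^1_\sigma)$, and put $$\tilde G=\frac{\sup_{t\ge t_0}\|f(t)\|}{\nu^2},\qquad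 \tilde\sigma_1=\frac{\sup_{t\ge t_0}\|A^{1/2}f(t)\|}{\sup_{t\ge t_0}\|f(t)\|}$$ (the value of $\tilde\sigma_1$ is immaterial if $f\equiv0$). Let $u$ be a strong solution of $\frac{d}{dt}u+\nu Au+B(u,u)=f$ on $[t_0,\infty)$ with $u(t_0)\in H^2_\sigma$ and $$\|A^{1/2}u(t_0)\|\le\nu\tilde G,\qquad \|Au(t_0)\|\le \tilde c_2\,\nu(\tilde G+\tilde\sigma_1)\tilde G .$$ **Algorithm.** Let $f_0\in C([t_0,\infty);L^2_\sigma)\cap L^\infty(t_0,\infty;L^2_\sigma)$ and $I_0=[t_0,\infty)$. At stage $n\ge1$, given $t_{n-1}$, $I_{n-1}=[t_{n-1},\infty)$ and $f_{n-1}$ on $I_{n-1}$, let $v_n$ be a strong solution, with arbitrary initial state $v_n(t_{n-1})\in H^1_\sigma$, of $$\frac{d}{dt}v_n+\nu Av_n+B(v_n,v_n)=f_{n-1}-\mu P_N(v_n-u)\quad\text{on } I_{n-1};$$ then choose a relaxation period $\rho_n>0$, set $t_n=t_{n-1}+\rho_n$, $I_n=[t_n,\infty)$, $u_n=P_Nu+Q_Nv_n$,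 and $f_n=\frac{d}{dt}P_Nu_n+\nu AP_Nu_n+P_NB(u_n,u_n)$ on $I_n$. Write $w_n=v_n-u$ and $g_n=f_n-f$. **Proposition.** There are universal constants $\overline c_0,C_1\ge1$ and, for every $\tilde c_2>0$, a constant $\underline c_0\ge1$ depending only on $\tilde c_2$, such that the following holds in the above setting whenever $$\underline c_0(\tilde\sigma_1+\tilde G)\tilde G^2\le\frac{\mu}{\nu}\le\overline c_0N^2 .$$ For each $n\ge1$, and whatever relaxation periods $\rho_1,\dots,\rho_{n-1}>0$ were chosen at the previous stages, $\sup_{t\in I_{n-1}}\|g_{n-1}(t)\|<\infty$; and if $g_{n-1}$ does not vanish identically on $I_{n-1}$, then there exists a relaxation period $\rho_n>0$ with $$\rho_n\ge\frac1\mu\ln\left[\frac{\mu}{C_1\nu}\left(\frac{\nu\|A^{1/2}w_n(t_{n-1})\|}{\sup_{t\in I_{n-1}}\|g_{n-1}(t)\|}\right)^2\right]\qquad(*)$$ (no condition if $w_n(t_{n-1})=0$) such that, with $I_n=[t_{n-1}+\rho_n,\infty)$, $$\sup_{t\in I_n}\frac{\|A^{1/2}w_n(t)\|}{\nu}\le\left(\frac{2C_1\nu}{\mu}\right)^{1/2}\frac{\sup_{t\in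 I_{n-1}}\|g_{n-1}(t)\|}{\nu^2};$$ in fact, every $\rho_n>0$ satisfying $(*)$ has this property. -/

import Mathlib

open MeasureTheory Set

noncomputable section

namespace Nudging

instance fact_two_pi_pos : Fact (0 < 2 * Real.pi) := ⟨Real.two_pi_pos⟩

/-- The periodic square `[0,2π]²`, that is `(ℝ / 2πℤ)²`, with Lebesgue measure (total mass `(2π)²`). -/
abbrev Torus : Type := Fin 2 → AddCircle (2 * Real.pi)

/-- Values of (real) planar vector fields, with the Euclidean norm. -/
abbrev Plane : Type := EuclideanSpace ℝ (Fin 2)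

/-- Square-integrable periodic real vector fields; the norm is `(∫ |u(x)|² dx)^{1/2}`. -/
abbrev L2 : Type := Lp Plane 2 (volume : Measure Torus)

/-- Wave vectors. -/
abbrev Wave : Type := Fin 2 → ℤ

/-- Families of vectorial Fourier coefficients. -/
abbrev Coeffs : Type := Wave → Fin 2 → ℂ

/-- `|k|²`. -/
def waveSq (k : Wave) : ℝ := (k 0 : ℝ) ^ 2 + (k 1 : ℝ) ^ 2

/-- Fourier coefficients `û(k) = (2π)⁻² ∫ u(x) e^{-i k·x} dx`, taken componentwise. -/
def fc (g : Torus → Plane) : Coeffs := fun k i =>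
  (((2 * Real.pi) ^ 2)⁻¹ : ℂ) * ∫ x : Torus, (∏ j, fourier (-(k j)) (x j)) * ((g x i : ℝ) : ℂ)

open Classical in
/-- The square-integrable real field with prescribed Fourier coefficients
(`0` if there is no such field). -/
def ofFourier (c : Coeffs) : L2 :=
  if h : ∃ w : L2, ∀ k i, fc w k i = c k i then h.choose else 0

/-- `L²_σ`: mean-free and divergence-free square-integrable fields. -/
def Lσ : Set L2 :=
  {u | (∀ i, fc u 0 i = 0) ∧ ∀ k : Wave, ∑ i, (k i : ℂ) * fc u k i = 0}

/-- `w` is the weak derivative `∂ⱼ u` (tested against the trigonometric functions `e^{-i k·x}`). -/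
def IsWeakPartial (j : Fin 2) (u w : L2) : Prop :=
  ∀ k i, fc w k i = Complex.I * (k j : ℂ) * fc u k i

/-- All weak derivatives of `u` up to order `m` exist and are square-integrable. -/
def MemH : ℕ → L2 → Prop
  | 0, _ => True
  | m + 1, u => ∀ j : Fin 2, ∃ w : L2, IsWeakPartial j u w ∧ MemH m w

/-- `Hᵐ_σ`. -/
def Hσ (m : ℕ) : Set L2 := {u | u ∈ Lσ ∧ MemH m u}

/-- The weak derivative `∂ⱼ u` of `u ∈ H¹`. -/
def partialD (j : Fin 2) (u : L2) : L2 := ofFourier fun k i => Complex.I * (k j : ℂ) * fc u k i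

/-- `A^{m/2}`, the power of the Stokes operator with Fourier symbol `|k|ᵐ`, on `Hᵐ_σ`. -/
def stokesPow (m : ℕ) (u : L2) : L2 :=
  ofFourier fun k i => ((Real.sqrt (waveSq k) ^ m : ℝ) : ℂ) * fc u k i

open Classical in
/-- Sharp truncation to the wave vectors with `|k| ≤ N`. -/
def trunc (N : ℕ) (c : Coeffs) : Coeffs := fun k i => if waveSq k ≤ (N : ℝ) ^ 2 then c k i else 0

/-- The action of the Leray projection (onto mean-free divergence-free fields) on Fourier
coefficients: `c(k) ↦ c(k) - (k·c(k)/|k|²) k` for `k ≠ 0`, and `0` for `k = 0`. -/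
def lerayCoeffs (c : Coeffs) : Coeffs := fun k i =>
  if k = 0 then 0 else c k i - (∑ j, (k j : ℂ) * c k j) / (waveSq k : ℂ) * (k i : ℂ)

/-- The projection `P_N` onto the wave vectors with `|k| ≤ N`. -/
def lowModes (N : ℕ) (u : L2) : L2 := ofFourier (trunc N (fc u))

/-- `(u·∇)v`. -/
def advect (u v : L2) : Torus → Plane := fun x => ∑ j, (u x j) • (partialD j v) x

/-- `B(u,v) = P (u·∇)v`, for `u, v` such that `(u·∇)v` is square-integrable. -/
def B (u v : L2) : L2 := ofFourier (lerayCoeffs (fc (advect u v)))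

/-- `P_N B(u,v)`; as a trigonometric polynomial it makes sense for all `u, v ∈ H¹_σ`, for which
`(u·∇)v` is merely integrable. -/
def lowB (N : ℕ) (u v : L2) : L2 := ofFourier (trunc N (lerayCoeffs (fc (advect u v))))

/-- `u` is a strong solution on `[a,∞)` of `du/dt + ν A u + B(u,u) = F`:
`u ∈ C([a,T];H¹_σ) ∩ L²(a,T;H²_σ)` and `du/dt ∈ L²(a,T;L²)` for every `T`, and the equation
holds in `L²` for almost every time. -/
structure IsStrongSolution (ν a : ℝ) (F u : ℝ → L2) : Prop where
  mem_H1 : ∀ t, a ≤ t → u t ∈ Hσ 1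
  cont_H1 : ContinuousOn (fun t => stokesPow 1 (u t)) (Ici a)
  mem_H2 : ∀ᵐ t ∂(volume.restrict (Ici a)), u t ∈ Hσ 2
  memLp_H2 : ∀ T : ℝ, MemLp (fun t => stokesPow 2 (u t)) 2 (volume.restrict (Icc a T))
  equation : ∃ u' : ℝ → L2,
    (∀ T : ℝ, MemLp u' 2 (volume.restrict (Icc a T))) ∧
    (∀ t, a ≤ t → u t = u a + ∫ s in a..t, u' s) ∧
    ∀ᵐ t ∂(volume.restrict (Ici a)), u' t + ν • stokesPow 2 (u t) + B (u t) (u t) = F t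

/-- `sup_{t ≥ a} ‖g(t)‖_{L²}` (meaningful when `g` is bounded on `[a,∞)`). -/
def supNorm (a : ℝ) (g : ℝ → L2) : ℝ := ⨆ t : Ici a, ‖g t‖

/-- `g ∈ L^∞`: `g` is bounded on `[a,∞)` with values in `L²`. -/
def BddOn (a : ℝ) (g : ℝ → L2) : Prop := BddAbove (range fun t : Ici a => ‖g t‖)

/-- The time-dependent Grashof number `sup_{t ≥ a} ‖f(t)‖ / ν²`. -/
def grashof (ν a : ℝ) (f : ℝ → L2) : ℝ := supNorm a f / ν ^ 2

/-- The shape factor `sup_{t ≥ a} ‖A^{1/2} f(t)‖ / sup_{t ≥ a} ‖f(t)‖`. -/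
def shape (a : ℝ) (f : ℝ → L2) : ℝ := supNorm a (fun t => stokesPow 1 (f t)) / supNorm a f

/-- The reconstructed state `P_N u + Q_N v`, with `Q_N = I - P_N`. -/
def recon (N : ℕ) (u v : L2) : L2 := lowModes N u + (v - lowModes N v)

/-- The standing assumptions on the force `f` and the reference flow `u` on `[t₀,∞)`:
`f ∈ C([t₀,∞);L²_σ) ∩ L^∞(t₀,∞;H¹_σ)`, `u` is the strong solution of the Navier-Stokes equations,
and the initial state lies in the absorbing balls
`‖A^{1/2}u(t₀)‖ ≤ ν G` and `‖A u(t₀)‖ ≤ c₂ ν (G + σ₁) G`. -/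
structure IsReference (c₂ ν t₀ : ℝ) (f u : ℝ → L2) : Prop where
  force_mem : ∀ t, t₀ ≤ t → f t ∈ Hσ 1
  force_cont : ContinuousOn f (Ici t₀)
  force_bdd : BddOn t₀ f
  force_bdd_H1 : BddOn t₀ fun t => stokesPow 1 (f t)
  solution : IsStrongSolution ν t₀ f u
  init_mem : u t₀ ∈ Hσ 2
  init_H1 : ‖stokesPow 1 (u t₀)‖ ≤ ν * grashof ν t₀ f
  init_H2 : ‖stokesPow 2 (u t₀)‖ ≤ c₂ * ν * (grashof ν t₀ f + shape t₀ f) * grashof ν t₀ f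

/-- A run of the force reconstruction algorithm up to the nudged system of stage `m + 1`.
Here `t 0 < t 1 < ⋯ < t m` are the left end points of the time intervals `I_k = [t k, ∞)`,
`F k` is the approximate force on `I_k` produced at stage `k` (`F 0` is the user's guess), and
`v (k + 1)` solves the nudged system of stage `k + 1` on `I_k`, from an arbitrary initial state
in `H¹_σ`. -/
structure IsRun (ν μ : ℝ) (N : ℕ) (t₀ : ℝ) (u : ℝ → L2) (m : ℕ)
    (t : ℕ → ℝ) (F v : ℕ → ℝ → L2) : Prop where
  time_zero : t 0 = t₀
  time_lt : ∀ k, k < m → t k < t (k + 1)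
  guess_mem : ∀ s, t₀ ≤ s → F 0 s ∈ Lσ
  guess_cont : ContinuousOn (F 0) (Ici t₀)
  guess_bdd : BddOn t₀ (F 0)
  nudged : ∀ k, k ≤ m →
    IsStrongSolution ν (t k) (fun s => F k s - μ • lowModes N (v (k + 1) s - u s)) (v (k + 1))
  /-- `f_{k+1} = d/dt P_N u_{k+1} + ν A P_N u_{k+1} + P_N B(u_{k+1},u_{k+1})` on `I_{k+1}`,
  where `u_{k+1} = P_N u + Q_N v_{k+1}`. -/
  update : ∀ k, k < m → ∀ s, t (k + 1) ≤ s →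
    HasDerivAt (fun r => lowModes N (recon N (u r) (v (k + 1) r)))
      (F (k + 1) s - ν • stokesPow 2 (lowModes N (recon N (u s) (v (k + 1) s)))
        - lowB N (recon N (u s) (v (k + 1) s)) (recon N (u s) (v (k + 1) s))) s

/-- The lower bound for the relaxation period,
`μ⁻¹ ln[ (μ/(C₁ν)) (ν ‖A^{1/2}w(a)‖ / sup_{t ≥ a}‖g(t)‖)² ]`. -/
def relaxBound (C₁ ν μ a : ℝ) (g w : ℝ → L2) : ℝ :=
  1 / μ * Real.log (μ / (C₁ * ν) * (ν * ‖stokesPow 1 (w a)‖ / supNorm a g) ^ 2)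

end Nudging

end

/-! The error `w = v - u` solves `w' + νAw + B(v,v) - B(u,u) = g - μ P_N w`, and the estimate comes
from pairing this equation with `Aw`.

Damping: for `|k| ≤ N` the nudging term damps the gradient at rate `μ`; for `|k| > N` viscosity
does, because `ν|k|² ≥ νN² ≥ μ` (`dissipation_le`).

Nonlinearity: up to a gradient, `(u·∇)u` is the Lamb vector `ω u^⊥`. Since `Aw` is a rotated
gradient of the vorticity of `w`, transport by a divergence-free field gives `∫ ω_w v^⊥·Aw = 0`
(`integral_vort_transport`), and of the difference only `∫ ω_u w^⊥·Aw` survives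
(`abs_inner_B_sub_le`). Hence only the enstrophy of `u` enters, and it is at most `(νG)²` for all
time (`IsReference.norm_grad_le`). The sup norm of `w` is controlled in `H^{4/3}`; interpolating
between `A^{1/2}w` and `Aw` costs a multiple of `G³` (`fracSq_interpolation`), which the lower
threshold on `μ/ν` dominates.

Altogether `d/dt ‖A^{1/2}w‖² ≤ -μ ‖A^{1/2}w‖² + (4/ν) ‖g‖²` (`error_rate_le`). Gronwall leaves a
decaying initial term plus `4 sup‖g‖²/(μν)`; the relaxation period is exactly the time after which
the first term is below the second. The balance is justified for strong solutions by differentiating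
single Fourier modes and summing by dominated convergence (`IsPath.enstrophy_eq`).

Finiteness of `sup‖g‖` is an induction on the stage (`IsReference.bddOn_error`): a bounded previous
error bounds the enstrophy of `v`, so `ν A P_N u_n` and `P_N B(u_n,u_n)` are trigonometric
polynomials with bounded coefficients, while `P_N u_n = P_N u` has Lipschitz coefficients by the
equation for `u`. -/

noncomputable section

namespace Nudging

/-! ### Scalar Fourier analysis on the torus: completeness, Parseval, products. -/

section TrigonometricBasis

open ComplexConjugate Algebra Submodule

/-- The trigonometric monomial `x ↦ e^{i k·x}`. -/
def monomial (k : Wave) : C(Torus, ℂ) where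
  toFun x := ∏ i, fourier (k i) (x i)
  continuous_toFun := by fun_prop

lemma monomial_neg (k : Wave) (x : Torus) : monomial (-k) x = conj (monomial k x) := by
  simp only [monomial, Pi.neg_apply, fourier_neg, ContinuousMap.coe_mk, map_prod]

lemma monomial_add (k l : Wave) (x : Torus) :
    monomial (k + l) x = monomial k x * monomial l x := by
  simp only [monomial, Pi.add_apply, fourier_add, ContinuousMap.coe_mk, ← Finset.prod_mul_distrib]

lemma monomial_zero (x : Torus) : monomial 0 x = 1 := by
  simp [monomial]

lemma norm_monomial_apply (k : Wave) (x : Torus) : ‖monomial k x‖ = 1 := by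
  simp only [monomial, fourier_apply, ContinuousMap.coe_mk, norm_prod, Circle.norm_coe,
    Finset.prod_const_one]

lemma norm_monomial (k : Wave) : ‖monomial k‖ = 1 := by
  apply le_antisymm
  · exact (ContinuousMap.norm_le _ zero_le_one).mpr fun x ↦ (norm_monomial_apply k x).le
  · exact (norm_monomial_apply k 0).ge.trans ((monomial k).norm_coe_le_norm 0)

lemma monomial_single (x : Torus) (i : Fin 2) :
    monomial (Pi.single i 1) x = fourier 1 (x i) := by
  fin_cases i <;> simp [monomial]

/-- The trigonometric polynomials, as a star subalgebra. -/
def trigSubalgebra : StarSubalgebra ℂ C(Torus, ℂ) where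
  toSubalgebra := Algebra.adjoin ℂ (range monomial)
  star_mem' := by
    change Algebra.adjoin ℂ (range monomial) ≤ star (Algebra.adjoin ℂ (range monomial))
    refine adjoin_le ?_
    rintro _ ⟨n, rfl⟩
    refine subset_adjoin ⟨-n, ?_⟩
    ext1 x
    simp only [monomial_neg, starRingEnd_apply, ContinuousMap.star_apply]

theorem trigSubalgebra_coe :
    trigSubalgebra.toSubalgebra.toSubmodule = span ℂ (range monomial) := by
  apply adjoin_eq_span_of_subset
  refine .trans (fun x ↦ Submonoid.closure_induction (fun _ ↦ id) ⟨0, ?_⟩ ?_) subset_span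
  · ext z
    simp [monomial_zero]
  · rintro _ _ _ _ ⟨m, rfl⟩ ⟨n, rfl⟩
    refine ⟨m + n, ?_⟩
    ext z
    simp [monomial_add]

theorem trigSubalgebra_separatesPoints : trigSubalgebra.SeparatesPoints := by
  intro x y hxy
  rw [Ne, funext_iff, not_forall] at hxy
  obtain ⟨i, hi⟩ := hxy
  refine ⟨_, ⟨monomial (Pi.single i 1), subset_adjoin ⟨Pi.single i 1, rfl⟩, rfl⟩, ?_⟩
  dsimp only
  rw [monomial_single, monomial_single, fourier_one, fourier_one]
  exact fun h => hi (AddCircle.injective_toCircle Real.two_pi_pos.ne' (Circle.ext h))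

theorem span_monomial_closure_eq_top :
    (span ℂ (range monomial)).topologicalClosure = ⊤ := by
  rw [← trigSubalgebra_coe]
  exact congr_arg (Subalgebra.toSubmodule <| StarSubalgebra.toSubalgebra ·)
    (ContinuousMap.starSubalgebra_topologicalClosure_eq_top_of_separatesPoints _
      trigSubalgebra_separatesPoints)

/-- Complex square-integrable functions on the torus. -/
abbrev CL2 : Type := Lp ℂ 2 (volume : Measure Torus)

/-- Trigonometric monomials as square-integrable functions. -/
def monomialL2 (k : Wave) : CL2 := ContinuousMap.toLp (E := ℂ) 2 volume ℂ (monomial k)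

theorem span_monomialL2_closure_eq_top :
    (span ℂ (range monomialL2)).topologicalClosure = ⊤ := by
  have := (ContinuousMap.toLp_denseRange (p := 2) ℂ (volume : Measure Torus) ℂ
    (by simp)).topologicalClosure_map_submodule span_monomial_closure_eq_top
  change (span ℂ (range fun k => ContinuousMap.toLp (E := ℂ) 2 volume ℂ
    (monomial k))).topologicalClosure = ⊤
  simpa only [map_span, ContinuousLinearMap.coe_coe, ← range_comp, Function.comp_def] using this

lemma integral_fourier (n : ℤ) :
    ∫ x : AddCircle (2 * Real.pi), fourier n x = if n = 0 then (2 * Real.pi : ℂ) else 0 := by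
  rw [AddCircle.volume_eq_smul_haarAddCircle, integral_smul_measure,
    ENNReal.toReal_ofReal Real.two_pi_pos.le]
  have h := (orthonormal_iff_ite.mp (orthonormal_fourier (T := 2 * Real.pi))) 0 n
  simp only [ContinuousMap.inner_toLp, ← fourier_neg, ← fourier_add] at h
  simp only [neg_zero, add_zero] at h
  rw [h]
  by_cases hn : n = 0 <;> simp [hn, eq_comm]

lemma integral_monomial (k : Wave) :
    ∫ x, monomial k x = if k = 0 then ((2 * Real.pi : ℂ)) ^ 2 else 0 := by
  simp only [monomial, ContinuousMap.coe_mk]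
  rw [MeasureTheory.integral_fintype_prod_volume_eq_prod (fun i => fun y => fourier (k i) y)]
  simp only [integral_fourier, Fin.prod_univ_two]
  split_ifs with h0 h1 h2 h3 h4 h5 h6 <;> simp_all [funext_iff, Fin.forall_fin_two, pow_two]

lemma inner_monomialL2 (k l : Wave) :
    inner ℂ (monomialL2 k) (monomialL2 l) = if k = l then ((2 * Real.pi : ℂ)) ^ 2 else 0 := by
  simp only [monomialL2, ContinuousMap.inner_toLp, ← monomial_neg, ← monomial_add,
    integral_monomial]
  congr 1
  rw [eq_iff_iff]
  constructor
  · intro h; rw [add_neg_eq_zero] at h; exact h.symm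
  · rintro rfl; simp

lemma orthonormal_monomialL2 :
    Orthonormal ℂ fun k => ((2 * Real.pi : ℝ) : ℂ)⁻¹ • monomialL2 k := by
  rw [orthonormal_iff_ite]
  intro k l
  have : (Real.pi : ℂ) ≠ 0 := by exact_mod_cast Real.pi_ne_zero
  rw [inner_smul_left, inner_smul_right, inner_monomialL2]
  split_ifs
  · simp only [map_inv₀, Complex.conj_ofReal]
    push_cast
    field_simp
  · simp

/-- The normalised trigonometric monomials form a Hilbert basis. -/
def trigBasis : HilbertBasis Wave ℂ CL2 :=
  HilbertBasis.mk orthonormal_monomialL2 (by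
    rw [← span_monomialL2_closure_eq_top]
    refine topologicalClosure_mono (span_le.mpr ?_)
    rintro _ ⟨k, rfl⟩
    have : monomialL2 k = ((2 * Real.pi : ℝ) : ℂ) • (((2 * Real.pi : ℝ) : ℂ)⁻¹ • monomialL2 k) := by
      rw [smul_smul, mul_inv_cancel₀, one_smul]
      exact_mod_cast Real.two_pi_pos.ne'
    rw [this]
    exact smul_mem _ _ (subset_span ⟨k, rfl⟩))

lemma trigBasis_apply (k : Wave) :
    trigBasis k = ((2 * Real.pi : ℝ) : ℂ)⁻¹ • monomialL2 k := by
  simp [trigBasis]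

/-- Fourier coefficients of a scalar function. -/
def sc (f : Torus → ℂ) (k : Wave) : ℂ :=
  (((2 * Real.pi) ^ 2)⁻¹ : ℂ) * ∫ x, monomial (-k) x * f x

lemma fc_eq_sc (g : Torus → Plane) (k : Wave) (i : Fin 2) :
    fc g k i = sc (fun x => ((g x i : ℝ) : ℂ)) k := rfl

lemma sc_congr {f g : Torus → ℂ} (h : f =ᵐ[volume] g) (k : Wave) : sc f k = sc g k := by
  unfold sc
  congr 1
  apply integral_congr_ae
  filter_upwards [h] with x hx
  rw [hx]

lemma integrable_monomial_mul {f : Torus → ℂ} (hf : Integrable f) (k : Wave) :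
    Integrable fun x => monomial k x * f x :=
  hf.bdd_mul (c := 1) (monomial k).continuous.aestronglyMeasurable
    (Filter.Eventually.of_forall fun x => (norm_monomial_apply k x).le)

lemma sc_add {f g : Torus → ℂ} (hf : Integrable f) (hg : Integrable g) (k : Wave) :
    sc (fun x => f x + g x) k = sc f k + sc g k := by
  unfold sc
  rw [← mul_add, ← integral_add (integrable_monomial_mul hf _) (integrable_monomial_mul hg _)]
  simp only [mul_add]

lemma sc_sub {f g : Torus → ℂ} (hf : Integrable f) (hg : Integrable g) (k : Wave) :
    sc (fun x => f x - g x) k = sc f k - sc g k := by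
  unfold sc
  rw [← mul_sub, ← integral_sub (integrable_monomial_mul hf _) (integrable_monomial_mul hg _)]
  simp only [mul_sub]

lemma sc_const_mul (c : ℂ) (f : Torus → ℂ) (k : Wave) :
    sc (fun x => c * f x) k = c * sc f k := by
  unfold sc
  simp only [mul_left_comm _ c, integral_const_mul]

lemma sc_conj (f : Torus → ℂ) (k : Wave) : sc (fun x => conj (f x)) k = conj (sc f (-k)) := by
  unfold sc
  rw [map_mul, ← integral_conj]
  simp [monomial_neg, Complex.conj_ofNat]

lemma norm_sc_le (f : Torus → ℂ) (k : Wave) :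
    ‖sc f k‖ ≤ ((2 * Real.pi) ^ 2)⁻¹ * ∫ x, ‖f x‖ := by
  unfold sc
  rw [norm_mul]
  have h : ‖(((2 * Real.pi) ^ 2)⁻¹ : ℂ)‖ = ((2 * Real.pi) ^ 2)⁻¹ := by
    simp [abs_of_pos Real.pi_pos]
  rw [h]
  gcongr
  refine (norm_integral_le_integral_norm _).trans (le_of_eq ?_)
  simp [norm_monomial_apply]

lemma trigBasis_repr (f : CL2) (k : Wave) :
    trigBasis.repr f k = (2 * Real.pi : ℂ) * sc f k := by
  rw [HilbertBasis.repr_apply_apply, trigBasis_apply, inner_smul_left, L2.inner_def]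
  have : ∫ x, inner ℂ (monomialL2 k x) (f x) = ∫ x, monomial (-k) x * f x := by
    apply integral_congr_ae
    filter_upwards [ContinuousMap.coeFn_toLp (p := 2) (𝕜 := ℂ) (volume : Measure Torus)
      (monomial k)] with x hx
    rw [monomialL2, hx, monomial_neg, RCLike.inner_apply, mul_comm]
  rw [this, sc]
  have : (Real.pi : ℂ) ≠ 0 := by exact_mod_cast Real.pi_ne_zero
  simp only [map_inv₀, Complex.conj_ofReal]
  push_cast
  field_simp

/-- **Parseval's identity**. -/
lemma hasSum_conj_sc_mul_sc {f g : Torus → ℂ} (hf : MemLp f 2) (hg : MemLp g 2) :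
    HasSum (fun k => conj (sc f k) * sc g k)
      ((((2 * Real.pi) ^ 2)⁻¹ : ℂ) * ∫ x, conj (f x) * g x) := by
  have h := trigBasis.hasSum_inner_mul_inner (hf.toLp f) (hg.toLp g)
  have e : inner ℂ (hf.toLp f) (hg.toLp g) = ∫ x, conj (f x) * g x := by
    rw [L2.inner_def]
    apply integral_congr_ae
    filter_upwards [hf.coeFn_toLp, hg.coeFn_toLp] with x h1 h2
    rw [h1, h2, RCLike.inner_apply, mul_comm]
  rw [e] at h
  refine (h.mul_left _).congr_fun fun k => ?_
  have e1 : inner ℂ (trigBasis k) (hg.toLp g) = (2 * Real.pi : ℂ) * sc g k := by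
    rw [← HilbertBasis.repr_apply_apply, trigBasis_repr, sc_congr hg.coeFn_toLp]
  have e2 : inner ℂ (hf.toLp f) (trigBasis k) = (2 * Real.pi : ℂ) * conj (sc f k) := by
    rw [← inner_conj_symm, ← HilbertBasis.repr_apply_apply, trigBasis_repr,
      sc_congr hf.coeFn_toLp]
    simp [Complex.conj_ofNat]
  rw [e1, e2]
  have : (Real.pi : ℂ) ≠ 0 := by exact_mod_cast Real.pi_ne_zero
  field_simp

lemma hasSum_norm_sc_sq {f : Torus → ℂ} (hf : MemLp f 2) :
    HasSum (fun k => ‖sc f k‖ ^ 2) (((2 * Real.pi) ^ 2)⁻¹ * ∫ x, ‖f x‖ ^ 2) := by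
  have h := hasSum_conj_sc_mul_sc hf hf
  simp only [← Complex.normSq_eq_conj_mul_self, Complex.normSq_eq_norm_sq] at h
  rw [integral_complex_ofReal] at h
  exact_mod_cast h

/-- **Riesz–Fischer**. -/
lemma exists_sc_eq {c : Wave → ℂ} (hc : Summable fun k => ‖c k‖ ^ 2) :
    ∃ f : CL2, ∀ k, sc f k = c k := by
  have hm : Memℓp (fun k => (2 * Real.pi : ℂ) * c k) 2 := by
    apply memℓp_gen
    simp only [norm_mul, mul_pow, ENNReal.toReal_ofNat, Real.rpow_two]
    exact hc.mul_left _
  refine ⟨trigBasis.repr.symm ⟨_, hm⟩, fun k => ?_⟩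
  have h := trigBasis_repr (trigBasis.repr.symm ⟨_, hm⟩) k
  rw [LinearIsometryEquiv.apply_symm_apply] at h
  have : (2 * Real.pi : ℂ) ≠ 0 := by exact_mod_cast Real.two_pi_pos.ne'
  exact (mul_left_cancel₀ this h).symm

lemma memLp_conj {f : Torus → ℂ} (hf : MemLp f 2) : MemLp (fun x => conj (f x)) 2 :=
  hf.star

lemma memLp_monomial_mul {f : Torus → ℂ} (hf : MemLp f 2) (k : Wave) :
    MemLp (fun x => monomial k x * f x) 2 := by
  refine hf.of_le ((monomial k).continuous.aestronglyMeasurable.mul hf.1)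
    (Filter.Eventually.of_forall fun x => ?_)
  simp [norm_monomial_apply]

/-- Fourier coefficients of a product of square-integrable functions. -/
lemma hasSum_sc_mul {f g : Torus → ℂ} (hf : MemLp f 2) (hg : MemLp g 2) (k : Wave) :
    HasSum (fun p => sc f p * sc g (k - p)) (sc (fun x => f x * g x) k) := by
  -- Parseval for `conj f` and `e^{-i k·x} g` is the convolution formula, up to reindexing by `p ↦
  -- -p`.
  have h := hasSum_conj_sc_mul_sc (memLp_conj hf) (memLp_monomial_mul hg (-k))
  have e : ∀ p, sc (fun x => monomial (-k) x * g x) p = sc g (k + p) := by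
    intro p
    unfold sc
    congr 1
    congr 1
    ext x
    rw [← mul_assoc, ← monomial_add]
    congr 2
    abel_nf
  simp only [e, sc_conj, Complex.conj_conj] at h
  rw [← (Equiv.neg Wave).hasSum_iff]
  convert h using 1
  · ext p
    simp [sub_eq_add_neg]
  · unfold sc
    congr 1
    congr 1
    ext x
    ring

/-- The Leibniz rule, in terms of Fourier coefficients. -/
lemma sc_leibniz {f g f' g' : Torus → ℂ} (hf : MemLp f 2) (hg : MemLp g 2)
    (hf' : MemLp f' 2) (hg' : MemLp g' 2) (j : Fin 2)
    (hff : ∀ k, sc f' k = Complex.I * (k j : ℂ) * sc f k)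
    (hgg : ∀ k, sc g' k = Complex.I * (k j : ℂ) * sc g k) (k : Wave) :
    sc (fun x => f x * g' x) k + sc (fun x => g x * f' x) k =
      Complex.I * (k j : ℂ) * sc (fun x => f x * g x) k := by
  have h1 := hasSum_sc_mul hf hg' k
  have h2 := hasSum_sc_mul hf' hg k
  have h3 := (hasSum_sc_mul hf hg k).mul_left (Complex.I * (k j : ℂ))
  have e : sc (fun x => g x * f' x) k = sc (fun x => f' x * g x) k := by
    simp only [mul_comm]
  rw [e]
  -- Termwise in the convolution the rule is `k_j = p_j + (k_j - p_j)`; the product itself need only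
  -- be integrable.
  refine (h1.add h2).unique (h3.congr_fun fun p => ?_)
  rw [hff, hgg]
  simp only [Pi.sub_apply]
  push_cast
  ring

end TrigonometricBasis

open ComplexConjugate

/-! ### Fourier coefficients of real vector fields. -/

lemma memLp_coord {g : Torus → Plane} (hg : MemLp g 2) (i : Fin 2) :
    MemLp (fun x => g x i) 2 :=
  (EuclideanSpace.proj (𝕜 := ℝ) i).comp_memLp' hg

lemma memLp_ofReal {f : Torus → ℝ} (hf : MemLp f 2) : MemLp (fun x => (f x : ℂ)) 2 :=
  Complex.ofRealCLM.comp_memLp' hf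

lemma memLp_ccoord (u : L2) (i : Fin 2) : MemLp (fun x => ((u x i : ℝ) : ℂ)) 2 :=
  memLp_ofReal (memLp_coord (Lp.memLp u) i)

lemma integrable_ccoord (u : L2) (i : Fin 2) : Integrable fun x => ((u x i : ℝ) : ℂ) :=
  (memLp_ccoord u i).integrable one_le_two

lemma fc_congr {f g : Torus → Plane} (h : f =ᵐ[volume] g) (k : Wave) (i : Fin 2) :
    fc f k i = fc g k i :=
  sc_congr (by filter_upwards [h] with x hx; rw [hx]) k

lemma fc_add (u v : L2) (k : Wave) (i : Fin 2) : fc (u + v : L2) k i = fc u k i + fc v k i := by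
  simp only [fc_eq_sc]
  rw [← sc_add (integrable_ccoord u i) (integrable_ccoord v i)]
  apply sc_congr
  filter_upwards [Lp.coeFn_add u v] with x hx
  rw [hx]
  simp

lemma fc_sub (u v : L2) (k : Wave) (i : Fin 2) : fc (u - v : L2) k i = fc u k i - fc v k i := by
  simp only [fc_eq_sc]
  rw [← sc_sub (integrable_ccoord u i) (integrable_ccoord v i)]
  apply sc_congr
  filter_upwards [Lp.coeFn_sub u v] with x hx
  rw [hx]
  simp

lemma fc_smul (a : ℝ) (u : L2) (k : Wave) (i : Fin 2) : fc (a • u : L2) k i = a * fc u k i := by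
  simp only [fc_eq_sc]
  rw [← sc_const_mul]
  apply sc_congr
  filter_upwards [Lp.coeFn_smul a u] with x hx
  simp [hx]

lemma sc_ofReal_neg (f : Torus → ℝ) (k : Wave) :
    sc (fun x => (f x : ℂ)) (-k) = conj (sc (fun x => (f x : ℂ)) k) := by
  have := sc_conj (fun x => (f x : ℂ)) (-k)
  simpa using this

lemma fc_neg (g : Torus → Plane) (k : Wave) (i : Fin 2) : fc g (-k) i = conj (fc g k i) :=
  sc_ofReal_neg _ k

/-- The contribution of the wave vector `k` to `‖u‖²`. -/
def modeSq (u : L2) (k : Wave) : ℝ := (2 * Real.pi) ^ 2 * ∑ i, ‖fc u k i‖ ^ 2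

/-- The contribution of the wave vector `k` to the inner product of `u` and `v`. -/
def modeInner (u v : L2) (k : Wave) : ℝ :=
  (2 * Real.pi) ^ 2 * ∑ i, (conj (fc u k i) * fc v k i).re

lemma modeSq_nonneg (u : L2) (k : Wave) : 0 ≤ modeSq u k := by
  unfold modeSq; positivity

lemma hasSum_modeInner (u v : L2) : HasSum (modeInner u v) (inner ℝ u v) := by
  have h : ∀ i, HasSum (fun k => (conj (fc u k i) * fc v k i).re)
      (((2 * Real.pi) ^ 2)⁻¹ * ∫ x, u x i * v x i) := by
    intro i
    have h := hasSum_conj_sc_mul_sc (memLp_ccoord u i) (memLp_ccoord v i)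
    simp only [Complex.conj_ofReal, ← Complex.ofReal_mul] at h
    rw [integral_complex_ofReal] at h
    have h' := Complex.hasSum_re h
    have e : (((2 * Real.pi : ℂ) ^ 2)⁻¹ * ((∫ x, u x i * v x i : ℝ) : ℂ)).re =
        ((2 * Real.pi) ^ 2)⁻¹ * ∫ x, u x i * v x i := by
      rw [← Complex.ofReal_re (((2 * Real.pi) ^ 2)⁻¹ * ∫ x, u x i * v x i)]
      congr 1
      push_cast
      rfl
    rw [e] at h'
    exact h'
  have h2 := (hasSum_sum fun i (_ : i ∈ Finset.univ) => h i).mul_left ((2 * Real.pi) ^ 2)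
  rw [← Finset.mul_sum, mul_inv_cancel_left₀ (by positivity), ← integral_finsetSum] at h2
  · rw [L2.inner_def]
    have e : ∀ x, inner ℝ (u x) (v x) = ∑ i, u x i * v x i := fun x => by
      simp only [PiLp.inner_apply, RCLike.inner_apply, conj_trivial, mul_comm]
    simp only [e]
    exact h2
  · intro i _
    exact (memLp_coord (Lp.memLp u) i).integrable_mul (memLp_coord (Lp.memLp v) i)

lemma modeInner_self (u : L2) (k : Wave) : modeInner u u k = modeSq u k := by
  unfold modeInner modeSq
  simp only [← Complex.normSq_eq_conj_mul_self, Complex.normSq_eq_norm_sq, Complex.ofReal_re]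

lemma hasSum_modeSq (u : L2) : HasSum (modeSq u) (‖u‖ ^ 2) := by
  have h := hasSum_modeInner u u
  rw [real_inner_self_eq_norm_sq] at h
  exact h.congr_fun fun k => (modeInner_self u k).symm

/-- Parseval makes the coefficients determine the field; identities between operators defined by
`ofFourier` are all checked this way. -/
lemma ext_fc {u v : L2} (h : ∀ k i, fc u k i = fc v k i) : u = v := by
  have h1 := hasSum_modeSq (u - v)
  have h2 : modeSq (u - v) = fun _ => 0 := by
    ext k
    simp only [modeSq, fc_sub, h, sub_self, norm_zero]
    simp
  rw [h2] at h1
  have h3 : ‖u - v‖ ^ 2 = 0 := h1.unique hasSum_zero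
  exact sub_eq_zero.mp (norm_eq_zero.mp (by simpa using h3))

/-- Real square-integrable fields with prescribed Fourier coefficients. -/
lemma exists_fc_eq {c : Coeffs} (hc : Summable fun k => ∑ i, ‖c k i‖ ^ 2)
    (hneg : ∀ k i, c (-k) i = conj (c k i)) : ∃ w : L2, ∀ k i, fc w k i = c k i := by
  have hs : ∀ i, ∃ f : CL2, ∀ k, sc f k = c k i := fun i =>
    exists_sc_eq (hc.of_nonneg_of_le (fun k => by positivity) fun k =>
      Finset.single_le_sum (f := fun i => ‖c k i‖ ^ 2) (fun j _ => by positivity)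
        (Finset.mem_univ i))
  choose f hf using hs
  -- Passing to real parts does not change the coefficients, because `hneg` makes them conjugate
  -- symmetric.
  have hre : ∀ i, MemLp (fun x => (f i x).re) 2 := fun i =>
    Complex.reCLM.comp_memLp' (Lp.memLp (f i))
  have hm : MemLp (fun x => (WithLp.toLp 2 fun i => (f i x).re : Plane)) 2 :=
    MemLp.of_eval_piLp hre
  refine ⟨hm.toLp _, fun k i => ?_⟩
  rw [fc_congr hm.coeFn_toLp, fc_eq_sc]
  have e : (fun x => (((WithLp.toLp 2 fun i => (f i x).re : Plane) i : ℝ) : ℂ)) =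
      fun x => (1 / 2 : ℂ) * (f i x + conj (f i x)) := by
    ext x
    rw [Complex.add_conj]
    simp
  have hi : Integrable (f i) := (Lp.memLp (f i)).integrable one_le_two
  rw [e, sc_const_mul, sc_add hi ((memLp_conj (Lp.memLp (f i))).integrable one_le_two), sc_conj,
    hf, hf, hneg, Complex.conj_conj]
  ring

lemma fc_ofFourier {c : Coeffs} (h : ∃ w : L2, ∀ k i, fc w k i = c k i) (k : Wave) (i : Fin 2) :
    fc (ofFourier c) k i = c k i := by
  unfold ofFourier
  rw [dif_pos h]
  exact h.choose_spec k i

/-- If no field has these coefficients, the default value `0` satisfies the bound too. Later bounds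
on `lowB` and on low modes therefore need no realisability check. -/
lemma norm_ofFourier_sq_le {c : Coeffs} {K : ℝ} (hK : 0 ≤ K)
    (h : HasSum (fun k => (2 * Real.pi) ^ 2 * ∑ i, ‖c k i‖ ^ 2) K) : ‖ofFourier c‖ ^ 2 ≤ K := by
  by_cases hc : ∃ w : L2, ∀ k i, fc w k i = c k i
  · have h1 := hasSum_modeSq (ofFourier c)
    refine (h1.unique (h.congr_fun fun k => ?_)).le
    simp [modeSq, fc_ofFourier hc]
  · unfold ofFourier
    rw [dif_neg hc]
    simpa using hK

/-! ### Sobolev regularity, Stokes powers and derivatives on the Fourier side. -/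

lemma waveSq_nonneg (k : Wave) : 0 ≤ waveSq k := by unfold waveSq; positivity

lemma waveSq_neg (k : Wave) : waveSq (-k) = waveSq k := by simp [waveSq]

lemma waveSq_zero : waveSq 0 = 0 := by simp [waveSq]

lemma one_le_waveSq {k : Wave} (hk : k ≠ 0) : 1 ≤ waveSq k := by
  have h : (0 : ℤ) < (k 0) ^ 2 + (k 1) ^ 2 := by
    rcases Function.ne_iff.mp hk with ⟨i, hi⟩
    fin_cases i
    · have : 0 < (k 0) ^ 2 := by have := sq_pos_of_ne_zero hi; exact this
      positivity
    · have : 0 < (k 1) ^ 2 := by have := sq_pos_of_ne_zero hi; exact this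
      positivity
  unfold waveSq
  exact_mod_cast h

/-- Sobolev regularity of order `m`, in terms of Fourier coefficients. -/
def Sob (m : ℕ) (u : L2) : Prop := Summable fun k => waveSq k ^ m * modeSq u k

/-- The derivatives in the two directions contribute `k₀²` and `k₁²`, whose sum is one factor `|k|²`
for each order. -/
lemma sob_of_memH {m : ℕ} {u : L2} (h : MemH m u) : Sob m u := by
  induction m generalizing u with
  | zero => simpa [Sob] using (hasSum_modeSq u).summable
  | succ m ih =>
    obtain ⟨w0, h0, m0⟩ := h 0
    obtain ⟨w1, h1, m1⟩ := h 1
    have e : ∀ (j : Fin 2) (w : L2), IsWeakPartial j u w → ∀ k,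
        modeSq w k = (k j : ℝ) ^ 2 * modeSq u k := by
      intro j w hw k
      simp only [modeSq, hw k, norm_mul, Complex.norm_I, one_mul, mul_pow, ← Finset.mul_sum,
        Complex.norm_intCast, sq_abs]
      ring
    refine ((ih m0).add (ih m1)).congr fun k => ?_
    rw [e 0 w0 h0, e 1 w1 h1, pow_succ]
    conv_rhs => rw [waveSq]
    unfold waveSq
    ring

lemma modeSq_sub_le (u v : L2) (k : Wave) :
    modeSq (u - v) k ≤ 2 * modeSq u k + 2 * modeSq v k := by
  have h : ∑ i, ‖fc (u - v : L2) k i‖ ^ 2 ≤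
      2 * (∑ i, ‖fc u k i‖ ^ 2) + 2 * ∑ i, ‖fc v k i‖ ^ 2 := by
    rw [Finset.mul_sum, Finset.mul_sum, ← Finset.sum_add_distrib]
    gcongr with i
    rw [fc_sub]
    have h := norm_sub_le (fc u k i) (fc v k i)
    nlinarith [norm_nonneg (fc u k i - fc v k i), sq_nonneg (‖fc u k i‖ - ‖fc v k i‖)]
  have := mul_le_mul_of_nonneg_left h (sq_nonneg (2 * Real.pi))
  unfold modeSq
  linarith

lemma Sob.sub {m : ℕ} {u v : L2} (hu : Sob m u) (hv : Sob m v) : Sob m (u - v) := by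
  refine ((hu.mul_left 2).add (hv.mul_left 2)).of_nonneg_of_le
    (fun k => mul_nonneg (pow_nonneg (waveSq_nonneg k) _) (modeSq_nonneg _ _)) fun k => ?_
  have := mul_le_mul_of_nonneg_left (modeSq_sub_le u v k) (pow_nonneg (waveSq_nonneg k) m)
  linarith

lemma fc_stokesPow {m : ℕ} {u : L2} (hu : Sob m u) (k : Wave) (i : Fin 2) :
    fc (stokesPow m u) k i = ((Real.sqrt (waveSq k) ^ m : ℝ) : ℂ) * fc u k i := by
  refine fc_ofFourier (exists_fc_eq ?_ fun k i => ?_) k i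
  · refine (hu.mul_left ((2 * Real.pi) ^ 2)⁻¹).congr fun k => ?_
    simp only [norm_mul, mul_pow, ← Finset.mul_sum, modeSq, Complex.norm_real, Real.norm_eq_abs,
      sq_abs]
    rw [← pow_mul, mul_comm m 2, pow_mul, Real.sq_sqrt (waveSq_nonneg k)]
    field_simp
  · rw [waveSq_neg, fc_neg, map_mul, Complex.conj_ofReal]

lemma fc_stokesPow_two {u : L2} (hu : Sob 2 u) (k : Wave) (i : Fin 2) :
    fc (stokesPow 2 u) k i = (waveSq k : ℂ) * fc u k i := by
  rw [fc_stokesPow hu, Real.sq_sqrt (waveSq_nonneg k)]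

lemma modeSq_stokesPow {m : ℕ} {u : L2} (hu : Sob m u) (k : Wave) :
    modeSq (stokesPow m u) k = waveSq k ^ m * modeSq u k := by
  simp only [modeSq, fc_stokesPow hu, norm_mul, mul_pow, ← Finset.mul_sum, Complex.norm_real,
    Real.norm_eq_abs, sq_abs]
  rw [← pow_mul, mul_comm m 2, pow_mul, Real.sq_sqrt (waveSq_nonneg k)]
  ring

lemma hasSum_stokesPow {m : ℕ} {u : L2} (hu : Sob m u) :
    HasSum (fun k => waveSq k ^ m * modeSq u k) (‖stokesPow m u‖ ^ 2) :=
  (hasSum_modeSq (stokesPow m u)).congr_fun fun k => (modeSq_stokesPow hu k).symm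

lemma stokesPow_sub {m : ℕ} {u v : L2} (hu : Sob m u) (hv : Sob m v) :
    stokesPow m (u - v) = stokesPow m u - stokesPow m v := by
  apply ext_fc
  intro k i
  rw [fc_stokesPow (hu.sub hv), fc_sub, fc_sub, fc_stokesPow hu, fc_stokesPow hv]
  ring

lemma fc_partialD {u : L2} (hu : Sob 1 u) (j : Fin 2) (k : Wave) (i : Fin 2) :
    fc (partialD j u) k i = Complex.I * (k j : ℂ) * fc u k i := by
  refine fc_ofFourier (exists_fc_eq ?_ fun k i => ?_) k i
  · refine (hu.mul_left ((2 * Real.pi) ^ 2)⁻¹).of_nonneg_of_le (fun k => by positivity) fun k => ?_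
    simp only [norm_mul, mul_pow, ← Finset.mul_sum, modeSq, Complex.norm_I, one_mul,
      Complex.norm_intCast, sq_abs, pow_one]
    rw [mul_left_comm, inv_mul_cancel_left₀ (by positivity)]
    gcongr
    fin_cases j <;> simp [waveSq] <;> positivity
  · rw [fc_neg, map_mul, map_mul, Complex.conj_I]
    simp

lemma modeSq_partialD {u : L2} (hu : Sob 1 u) (j : Fin 2) (k : Wave) :
    modeSq (partialD j u) k = (k j : ℝ) ^ 2 * modeSq u k := by
  simp only [modeSq, fc_partialD hu, norm_mul, Complex.norm_I, one_mul, mul_pow, ← Finset.mul_sum,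
    Complex.norm_intCast, sq_abs]
  ring

lemma norm_partialD_sq_add {u : L2} (hu : Sob 1 u) :
    ‖partialD 0 u‖ ^ 2 + ‖partialD 1 u‖ ^ 2 = ‖stokesPow 1 u‖ ^ 2 := by
  refine ((hasSum_modeSq (partialD 0 u)).add (hasSum_modeSq (partialD 1 u))).unique
    ((hasSum_stokesPow hu).congr_fun fun k => ?_)
  rw [modeSq_partialD hu, modeSq_partialD hu, waveSq]
  ring

lemma partialD_sub {u v : L2} (hu : Sob 1 u) (hv : Sob 1 v) (j : Fin 2) :
    partialD j (u - v) = partialD j u - partialD j v := by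
  apply ext_fc
  intro k i
  rw [fc_partialD (hu.sub hv), fc_sub, fc_sub, fc_partialD hu, fc_partialD hv]
  ring

lemma Sob.mono {m n : ℕ} (hmn : m ≤ n) {u : L2} (h : Sob n u) : Sob m u := by
  -- The `L²` sum is added for the mode `k = 0`, where `0 ^ m` equals `1` when `m = 0`.
  refine (h.add (hasSum_modeSq u).summable).of_nonneg_of_le
    (fun k => mul_nonneg (pow_nonneg (waveSq_nonneg k) _) (modeSq_nonneg _ _)) fun k => ?_
  have h0 := modeSq_nonneg u k
  by_cases hk : k = 0
  · subst hk
    rw [waveSq_zero]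
    have h1 : (0 : ℝ) ^ m ≤ 1 := pow_le_one₀ le_rfl zero_le_one
    have h2 : (0 : ℝ) ≤ 0 ^ n := by positivity
    nlinarith
  · have := pow_le_pow_right₀ (one_le_waveSq hk) hmn
    nlinarith

lemma trunc_neg {N : ℕ} {c : Coeffs} (hc : ∀ k i, c (-k) i = conj (c k i)) (k : Wave) (i : Fin 2) :
    trunc N c (-k) i = conj (trunc N c k i) := by
  unfold trunc
  rw [waveSq_neg, hc]
  split_ifs <;> simp

lemma fc_lowModes (N : ℕ) (u : L2) (k : Wave) (i : Fin 2) :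
    fc (lowModes N u) k i = trunc N (fc u) k i := by
  refine fc_ofFourier (exists_fc_eq ?_ (trunc_neg (fc_neg u))) k i
  refine ((hasSum_modeSq u).summable.mul_left ((2 * Real.pi) ^ 2)⁻¹).of_nonneg_of_le
    (fun k => by positivity) fun k => ?_
  unfold modeSq
  rw [inv_mul_cancel_left₀ (by positivity)]
  gcongr with i
  unfold trunc
  split_ifs <;> simp

lemma norm_fc_le (u : L2) (k : Wave) (i : Fin 2) : ‖fc u k i‖ ≤ (2 * Real.pi)⁻¹ * ‖u‖ := by
  have h1 := (hasSum_modeSq u).summable.le_tsum k (fun l _ => modeSq_nonneg u l)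
  rw [(hasSum_modeSq u).tsum_eq, modeSq] at h1
  have h2 := Finset.single_le_sum (f := fun i => ‖fc u k i‖ ^ 2) (fun j _ => by positivity)
      (Finset.mem_univ i)
  have h3 : (2 * Real.pi * ‖fc u k i‖) ^ 2 ≤ ‖u‖ ^ 2 := by
    refine le_trans ?_ h1
    rw [mul_pow]
    gcongr
  have h4 := abs_le_of_sq_le_sq h3 (norm_nonneg u)
  rw [inv_mul_eq_div, le_div_iff₀ Real.two_pi_pos]
  linarith [le_abs_self (2 * Real.pi * ‖fc u k i‖)]

/-- Fourier coefficients as continuous linear functionals. -/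
def fcL (k : Wave) (i : Fin 2) : L2 →L[ℝ] ℂ :=
  LinearMap.mkContinuous
    { toFun := fun u => fc u k i
      map_add' := fun u v => fc_add u v k i
      map_smul' := fun a u => by simp [fc_smul] } (2 * Real.pi)⁻¹ fun u => norm_fc_le u k i

lemma fcL_apply (k : Wave) (i : Fin 2) (u : L2) : fcL k i u = fc u k i := rfl

/-! ### Absolutely convergent Fourier series and the embedding of `H^{4/3}` into bounded functions.
-/

section AbsolutelySummable

variable {f : Torus → ℂ}

/-- A function with absolutely summable Fourier coefficients is the sum of its Fourier series. -/
lemma ae_eq_tsum_of_summable (hf : MemLp f 2) (hs : Summable fun k => ‖sc f k‖) :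
    f =ᵐ[volume] fun x => ∑' k, sc f k * monomial k x := by
  have hsum : Summable fun k => sc f k • monomial k := by
    refine Summable.of_norm (hs.congr fun k => ?_)
    rw [norm_smul, norm_monomial, mul_one]
  obtain ⟨F, hF⟩ := hsum
  have h1 := (ContinuousMap.toLp (E := ℂ) 2 (volume : Measure Torus) ℂ).hasSum hF
  have h2 := trigBasis.hasSum_repr (hf.toLp f)
  have e : ContinuousMap.toLp (E := ℂ) 2 (volume : Measure Torus) ℂ F = hf.toLp f := by
    refine h1.unique (h2.congr_fun fun k => ?_)
    rw [trigBasis_repr, trigBasis_apply, sc_congr hf.coeFn_toLp, smul_smul, map_smul]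
    congr 1
    have : (Real.pi : ℂ) ≠ 0 := by exact_mod_cast Real.pi_ne_zero
    push_cast
    field_simp
  have h3 := ContinuousMap.coeFn_toLp (p := 2) (𝕜 := ℂ) (volume : Measure Torus) F
  rw [e] at h3
  filter_upwards [h3, hf.coeFn_toLp] with x h4 h5
  rw [← h5, h4]
  have h6 := (ContinuousMap.evalCLM ℂ x).hasSum hF
  simpa using h6.tsum_eq.symm

lemma norm_le_tsum_norm_sc (hf : MemLp f 2) (hs : Summable fun k => ‖sc f k‖) :
    ∀ᵐ x, ‖f x‖ ≤ ∑' k, ‖sc f k‖ := by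
  filter_upwards [ae_eq_tsum_of_summable hf hs] with x hx
  rw [hx]
  refine (norm_tsum_le_tsum_norm ?_).trans_eq ?_
  · simpa [norm_monomial_apply] using hs
  · simp [norm_monomial_apply]

/-- Parseval beyond the `L²` pairing: absolute summability on one side allows termwise integration
against a merely integrable `h`. It is needed for `h = ω ∂ω`. -/
lemma hasSum_sc_mul_sc_neg (hf : MemLp f 2) (hs : Summable fun k => ‖sc f k‖) {h : Torus → ℂ}
    (hh : Integrable h) :
    HasSum (fun k => sc f k * sc h (-k)) ((((2 * Real.pi) ^ 2)⁻¹ : ℂ) * ∫ x, f x * h x) := by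
  have h1 := hasSum_integral_of_summable_integral_norm (μ := volume)
    (F := fun k x => sc f k * (monomial k x * h x))
    (fun k => (integrable_monomial_mul hh k).const_mul _) (by
      simp only [norm_mul, norm_monomial_apply, one_mul, integral_const_mul]
      exact hs.mul_right _)
  have h2 : ∫ x, ∑' k, sc f k * (monomial k x * h x) = ∫ x, f x * h x := by
    apply integral_congr_ae
    filter_upwards [ae_eq_tsum_of_summable hf hs] with x hx
    rw [hx, ← tsum_mul_right]
    simp only [mul_assoc]
  rw [h2] at h1
  refine (h1.mul_left _).congr_fun fun k => ?_
  rw [integral_const_mul]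
  unfold sc
  simp only [neg_neg]
  ring

end AbsolutelySummable

lemma norm_sq_le_waveSq (k : Wave) : ‖k‖ ^ 2 ≤ waveSq k := by
  have h : ‖k‖ ≤ Real.sqrt (waveSq k) := by
    rw [pi_norm_le_iff_of_nonneg (Real.sqrt_nonneg _)]
    intro i
    apply Real.le_sqrt_of_sq_le
    rw [Int.norm_eq_abs, sq_abs]
    fin_cases i <;> simp [waveSq] <;> positivity
  calc ‖k‖ ^ 2 ≤ Real.sqrt (waveSq k) ^ 2 := by gcongr
    _ = waveSq k := Real.sq_sqrt (waveSq_nonneg k)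

/-- The exponent `8/3` of `|k|` exceeds the dimension `2`. -/
lemma summable_waveSq_rpow : Summable fun k : Wave => waveSq k ^ (-(4 / 3) : ℝ) := by
  have h := EisensteinSeries.summable_one_div_norm_rpow (k := 8 / 3) (by norm_num)
  refine h.of_nonneg_of_le (fun k => Real.rpow_nonneg (waveSq_nonneg k) _) fun k => ?_
  by_cases hk : k = 0
  · subst hk
    rw [waveSq_zero, norm_zero, Real.zero_rpow (by norm_num), Real.zero_rpow (by norm_num)]
  · have h1 : 0 < ‖k‖ := norm_pos_iff.mpr hk
    calc waveSq k ^ (-(4 / 3) : ℝ) ≤ (‖k‖ ^ 2) ^ (-(4 / 3) : ℝ) :=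
          Real.rpow_le_rpow_of_nonpos (by positivity) (norm_sq_le_waveSq k) (by norm_num)
      _ = ‖k‖ ^ (-(8 / 3) : ℝ) := by
          rw [← Real.rpow_natCast, ← Real.rpow_mul h1.le]
          norm_num

/-- The constant in the embedding of `H^{4/3}` into the bounded functions. -/
def sobolevConst : ℝ := ((2 * Real.pi) ^ 2)⁻¹ * ∑' k : Wave, waveSq k ^ (-(4 / 3) : ℝ)

lemma sobolevConst_nonneg : 0 ≤ sobolevConst :=
  mul_nonneg (by positivity) (tsum_nonneg fun k => Real.rpow_nonneg (waveSq_nonneg k) _)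

/-- The square of the `H^{4/3}` norm. -/
def fracSq (w : L2) : ℝ := ∑' k, waveSq k ^ (4 / 3 : ℝ) * modeSq w k

lemma waveSq_rpow_le_sq (k : Wave) : waveSq k ^ (4 / 3 : ℝ) ≤ waveSq k ^ 2 := by
  by_cases hk : k = 0
  · subst hk
    rw [waveSq_zero, Real.zero_rpow (by norm_num)]
    norm_num
  · rw [← Real.rpow_two]
    exact Real.rpow_le_rpow_of_exponent_le (one_le_waveSq hk) (by norm_num)

lemma summable_fracSq {w : L2} (hw : Sob 2 w) :
    Summable fun k => waveSq k ^ (4 / 3 : ℝ) * modeSq w k :=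
  hw.of_nonneg_of_le
    (fun k => mul_nonneg (Real.rpow_nonneg (waveSq_nonneg k) _) (modeSq_nonneg w k)) fun k =>
    mul_le_mul_of_nonneg_right (waveSq_rpow_le_sq k) (modeSq_nonneg w k)

/-- Cauchy–Schwarz for series, passed to the limit from finite sums; the summability of `a` is part
of the conclusion. -/
lemma tsum_sq_le_of_sq_le_mul {ι : Type*} {a b c : ι → ℝ} (ha : ∀ k, 0 ≤ a k) (hb : ∀ k, 0 ≤ b k)
    (hc : ∀ k, 0 ≤ c k) (h : ∀ k, a k ^ 2 ≤ b k * c k) (sb : Summable b) (scc : Summable c) :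
    Summable a ∧ (∑' k, a k) ^ 2 ≤ (∑' k, b k) * ∑' k, c k := by
  have h1 : ∀ k, a k ≤ b k + c k := fun k => by
    nlinarith [h k, ha k, hb k, hc k, sq_nonneg (b k - c k)]
  have sa : Summable a := (sb.add scc).of_nonneg_of_le ha h1
  refine ⟨sa, ?_⟩
  refine le_of_tendsto (sa.hasSum.pow 2) (Filter.Eventually.of_forall fun s => ?_)
  calc (∑ k ∈ s, a k) ^ 2 ≤ (∑ k ∈ s, b k) * ∑ k ∈ s, c k :=
        Finset.sum_sq_le_sum_mul_sum_of_sq_le_mul s (fun k _ => hb k) (fun k _ => hc k)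
          fun k _ => h k
    _ ≤ _ := by
        gcongr
        · exact Finset.sum_nonneg fun k _ => hc k
        · exact tsum_nonneg hb
        · exact sb.sum_le_tsum s fun k _ => hb k
        · exact scc.sum_le_tsum s fun k _ => hc k

section Embedding

variable {w : L2}

/-- Cauchy–Schwarz with the weights `|k|^{±8/3}`. Vanishing mean takes care of `k = 0`, where both
weights are `0`. -/
lemma summable_fc_and_tsum_sq_le (hw : Sob 2 w) (h0 : ∀ i, fc w 0 i = 0) (i : Fin 2) :
    Summable (fun k => ‖fc w k i‖) ∧ (∑' k, ‖fc w k i‖) ^ 2 ≤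
      (∑' k : Wave, waveSq k ^ (-(4 / 3) : ℝ)) * ∑' k, waveSq k ^ (4 / 3 : ℝ) * ‖fc w k i‖ ^ 2 := by
  refine tsum_sq_le_of_sq_le_mul (fun k => norm_nonneg _)
    (fun k => Real.rpow_nonneg (waveSq_nonneg k) _)
    (fun k => mul_nonneg (Real.rpow_nonneg (waveSq_nonneg k) _) (sq_nonneg _)) (fun k => ?_)
    summable_waveSq_rpow ?_
  · by_cases hk : k = 0
    · subst hk
      simp [h0]
    · have : 0 < waveSq k := by linarith [one_le_waveSq hk]
      rw [← mul_assoc, ← Real.rpow_add this]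
      simp
  · refine ((summable_fracSq hw).mul_left ((2 * Real.pi) ^ 2)⁻¹).of_nonneg_of_le
      (fun k => mul_nonneg (Real.rpow_nonneg (waveSq_nonneg k) _) (sq_nonneg _)) fun k => ?_
    unfold modeSq
    rw [mul_left_comm, inv_mul_cancel_left₀ (by positivity)]
    have := Real.rpow_nonneg (waveSq_nonneg k) (4 / 3)
    gcongr
    exact Finset.single_le_sum (f := fun i => ‖fc w k i‖ ^ 2) (fun j _ => by positivity)
        (Finset.mem_univ i)

lemma summable_norm_fc (hw : Sob 2 w) (h0 : ∀ i, fc w 0 i = 0) (i : Fin 2) :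
    Summable fun k => ‖fc w k i‖ := (summable_fc_and_tsum_sq_le hw h0 i).1

lemma abs_coord_le (hw : Sob 2 w) (h0 : ∀ i, fc w 0 i = 0) (i : Fin 2) :
    ∀ᵐ x, |w x i| ≤ ∑' k, ‖fc w k i‖ := by
  filter_upwards [norm_le_tsum_norm_sc (memLp_ccoord w i) (summable_norm_fc hw h0 i)] with x hx
  simpa only [Complex.norm_real, Real.norm_eq_abs, fc_eq_sc] using hx

/-- The Sobolev embedding of `H^{4/3}` into the bounded functions. -/
lemma sq_add_sq_le_fracSq (hw : Sob 2 w) (h0 : ∀ i, fc w 0 i = 0) :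
    ∀ᵐ x, w x 0 ^ 2 + w x 1 ^ 2 ≤ sobolevConst * fracSq w := by
  have hs : ∀ i, Summable fun k => waveSq k ^ (4 / 3 : ℝ) * ‖fc w k i‖ ^ 2 := fun i => by
    refine ((summable_fracSq hw).mul_left ((2 * Real.pi) ^ 2)⁻¹).of_nonneg_of_le
      (fun k => mul_nonneg (Real.rpow_nonneg (waveSq_nonneg k) _) (sq_nonneg _)) fun k => ?_
    unfold modeSq
    rw [mul_left_comm, inv_mul_cancel_left₀ (by positivity)]
    have := Real.rpow_nonneg (waveSq_nonneg k) (4 / 3)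
    gcongr
    exact Finset.single_le_sum (f := fun i => ‖fc w k i‖ ^ 2) (fun j _ => by positivity)
        (Finset.mem_univ i)
  have e : fracSq w = (2 * Real.pi) ^ 2 * ((∑' k, waveSq k ^ (4 / 3 : ℝ) * ‖fc w k 0‖ ^ 2) +
      ∑' k, waveSq k ^ (4 / 3 : ℝ) * ‖fc w k 1‖ ^ 2) := by
    rw [← (hs 0).tsum_add (hs 1), ← tsum_mul_left]
    apply tsum_congr
    intro k
    rw [modeSq, Fin.sum_univ_two]
    ring
  have hb := fun i => (summable_fc_and_tsum_sq_le hw h0 i).2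
  have hsq : ∀ i, ∀ᵐ x, w x i ^ 2 ≤ (∑' k, ‖fc w k i‖) ^ 2 := fun i => by
    filter_upwards [abs_coord_le hw h0 i] with x hx
    rw [← sq_abs]
    gcongr
  filter_upwards [hsq 0, hsq 1] with x h1 h2
  refine (add_le_add (h1.trans (hb 0)) (h2.trans (hb 1))).trans_eq ?_
  rw [e, sobolevConst, ← mul_add]
  field_simp

lemma memLp_mul_coord (hw : Sob 2 w) (h0 : ∀ i, fc w 0 i = 0) (i : Fin 2) {g : Torus → ℝ}
    (hg : MemLp g 2) : MemLp (fun x => w x i * g x) 2 := by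
  refine MemLp.of_le_mul (c := ∑' k, ‖fc w k i‖) hg
    ((memLp_coord (Lp.memLp w) i).1.mul hg.1) ?_
  filter_upwards [abs_coord_le hw h0 i] with x hx
  rw [norm_mul]
  exact mul_le_mul_of_nonneg_right hx (norm_nonneg _)

end Embedding

/-! ### The nonlinearity in vorticity form and the trilinear estimate. -/

/-- The vorticity. -/
def vort (u : L2) (x : Torus) : ℝ := partialD 0 u x 1 - partialD 1 u x 0

/-- The Lamb vector `ω u^⊥`. -/
def lamb (u : L2) (x : Torus) : Plane :=
  WithLp.toLp 2 ![-(u x 1 * vort u x), u x 0 * vort u x]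

lemma memLp_vort (u : L2) : MemLp (vort u) 2 :=
  (memLp_coord (Lp.memLp _) 1).sub (memLp_coord (Lp.memLp _) 0)

lemma sc_vort {u : L2} (hu : Sob 1 u) (k : Wave) :
    sc (fun x => (vort u x : ℂ)) k = Complex.I * (k 0 * fc u k 1 - k 1 * fc u k 0) := by
  have := sc_sub (integrable_ccoord (partialD 0 u) 1) (integrable_ccoord (partialD 1 u) 0) k
  simp only [← fc_eq_sc, fc_partialD hu] at this
  unfold vort
  push_cast
  rw [this]
  ring

lemma memLp_lamb {u : L2} (hu : Sob 2 u) (h0 : ∀ i, fc u 0 i = 0) : MemLp (lamb u) 2 := by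
  refine MemLp.of_eval_piLp fun i => ?_
  fin_cases i
  · exact (memLp_mul_coord hu h0 1 (memLp_vort u)).neg
  · exact memLp_mul_coord hu h0 0 (memLp_vort u)

lemma advect_apply (u v : L2) (x : Torus) (i : Fin 2) :
    advect u v x i = u x 0 * partialD 0 v x i + u x 1 * partialD 1 v x i := by
  simp [advect, Fin.sum_univ_two]

lemma memLp_advect {u : L2} (v : L2) (hu : Sob 2 u) (h0 : ∀ i, fc u 0 i = 0) :
    MemLp (advect u v) 2 := by
  refine MemLp.of_eval_piLp fun i => ?_
  simp only [advect_apply]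
  exact (memLp_mul_coord hu h0 0 (memLp_coord (Lp.memLp _) i)).add
    (memLp_mul_coord hu h0 1 (memLp_coord (Lp.memLp _) i))

/-- `(u·∇)u` is the sum of a gradient and of the Lamb vector. -/
lemma fc_advect_self {u : L2} (hu : Sob 1 u) (k : Wave) (i : Fin 2) :
    fc (advect u u) k i = (k i : ℂ) * (Complex.I / 2 *
      (sc (fun x => ((u x 0 : ℝ) : ℂ) * ((u x 0 : ℝ) : ℂ)) k +
        sc (fun x => ((u x 1 : ℝ) : ℂ) * ((u x 1 : ℝ) : ℂ)) k)) + fc (lamb u) k i := by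
  have hL : ∀ a : Fin 2, 2 * sc (fun x => ((u x a : ℝ) : ℂ) * ((partialD i u x a : ℝ) : ℂ)) k =
      Complex.I * (k i : ℂ) * sc (fun x => ((u x a : ℝ) : ℂ) * ((u x a : ℝ) : ℂ)) k := fun a => by
    rw [← sc_leibniz (memLp_ccoord u a) (memLp_ccoord u a) (memLp_ccoord (partialD i u) a)
      (memLp_ccoord (partialD i u) a) i (fun k => fc_partialD hu i k a)
      (fun k => fc_partialD hu i k a)]
    ring
  have hm : ∀ (a : Fin 2), Integrable
      fun x => ((u x a : ℝ) : ℂ) * ((partialD i u x a : ℝ) : ℂ) := fun a =>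
    (memLp_ccoord u a).integrable_mul (memLp_ccoord (partialD i u) a)
  have hl : Integrable fun x => ((lamb u x i : ℝ) : ℂ) := by
    fin_cases i
    · have := ((memLp_ccoord u 1).integrable_mul (memLp_ofReal (memLp_vort u))).neg
      refine this.congr (Filter.Eventually.of_forall fun x => ?_)
      simp [lamb]
    · have := ((memLp_ccoord u 0).integrable_mul (memLp_ofReal (memLp_vort u)))
      refine this.congr (Filter.Eventually.of_forall fun x => ?_)
      simp [lamb]
  have e : (fun x => ((advect u u x i : ℝ) : ℂ)) = fun x =>
      (((u x 0 : ℝ) : ℂ) * ((partialD i u x 0 : ℝ) : ℂ) +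
        ((u x 1 : ℝ) : ℂ) * ((partialD i u x 1 : ℝ) : ℂ)) + ((lamb u x i : ℝ) : ℂ) := by
    ext x
    rw [advect_apply]
    fin_cases i <;> simp [lamb, vort] <;> ring
  have hm2 : Integrable fun x => ((u x 0 : ℝ) : ℂ) * ((partialD i u x 0 : ℝ) : ℂ) +
      ((u x 1 : ℝ) : ℂ) * ((partialD i u x 1 : ℝ) : ℂ) := (hm 0).add (hm 1)
  rw [fc_eq_sc, e, sc_add hm2 hl, sc_add (hm 0) (hm 1), ← fc_eq_sc]
  linear_combination (1 / 2 : ℂ) * hL 0 + (1 / 2 : ℂ) * hL 1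

lemma norm_lerayCoeffs_le (c : Coeffs) (k : Wave) (i : Fin 2) :
    ‖lerayCoeffs c k i‖ ≤ 2 * (‖c k 0‖ + ‖c k 1‖) := by
  unfold lerayCoeffs
  split_ifs with hk
  · simp; positivity
  have hW := one_le_waveSq hk
  have hki : ∀ j : Fin 2, |(k j : ℝ)| * |(k i : ℝ)| ≤ waveSq k := by
    intro j
    have h0 : ∀ a : Fin 2, |(k a : ℝ)| ^ 2 ≤ waveSq k := by
      intro a
      rw [sq_abs]
      fin_cases a <;> simp [waveSq] <;> positivity
    nlinarith [h0 i, h0 j, sq_nonneg (|(k j : ℝ)| - |(k i : ℝ)|)]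
  have h1 : ‖(∑ j, (k j : ℂ) * c k j) / (waveSq k : ℂ) * (k i : ℂ)‖ ≤ ‖c k 0‖ + ‖c k 1‖ := by
    rw [norm_mul, norm_div, Complex.norm_real, Real.norm_of_nonneg (waveSq_nonneg k),
      div_mul_eq_mul_div, div_le_iff₀ (by linarith), Fin.sum_univ_two, Complex.norm_intCast]
    calc _ ≤ (|(k 0 : ℝ)| * ‖c k 0‖ + |(k 1 : ℝ)| * ‖c k 1‖) * |(k i : ℝ)| := by
          gcongr
          refine (norm_add_le _ _).trans_eq ?_
          simp
      _ = (|(k 0 : ℝ)| * |(k i : ℝ)|) * ‖c k 0‖ + (|(k 1 : ℝ)| * |(k i : ℝ)|) * ‖c k 1‖ := by ring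
      _ ≤ waveSq k * ‖c k 0‖ + waveSq k * ‖c k 1‖ := by
          gcongr
          · exact hki 0
          · exact hki 1
      _ = _ := by ring
  have h2 : ‖c k i‖ ≤ ‖c k 0‖ + ‖c k 1‖ := by
    fin_cases i <;> simp
  linarith [norm_sub_le (c k i) ((∑ j, (k j : ℂ) * c k j) / (waveSq k : ℂ) * (k i : ℂ))]

lemma lerayCoeffs_neg {c : Coeffs} (hc : ∀ k i, c (-k) i = conj (c k i)) (k : Wave) (i : Fin 2) :
    lerayCoeffs c (-k) i = conj (lerayCoeffs c k i) := by
  unfold lerayCoeffs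
  by_cases hk : k = 0
  · simp [hk]
  · rw [if_neg hk, if_neg (by simpa using hk)]
    simp [hc, waveSq_neg]
    ring

lemma fc_leray {g : Torus → Plane} (hg : MemLp g 2) (k : Wave) (i : Fin 2) :
    fc (ofFourier (lerayCoeffs (fc g))) k i = lerayCoeffs (fc g) k i := by
  refine fc_ofFourier (exists_fc_eq ?_ (lerayCoeffs_neg (fc_neg g))) k i
  have hs : ∀ i, Summable fun k => ‖fc g k i‖ ^ 2 := fun i =>
    (hasSum_norm_sc_sq (memLp_ofReal (memLp_coord hg i))).summable
  refine (((hs 0).add (hs 1)).mul_left 16).of_nonneg_of_le (fun k => by positivity) fun k => ?_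
  rw [Fin.sum_univ_two]
  have h : ∀ i, ‖lerayCoeffs (fc g) k i‖ ^ 2 ≤ 8 * (‖fc g k 0‖ ^ 2 + ‖fc g k 1‖ ^ 2) := fun i => by
    have h1 := norm_lerayCoeffs_le (fc g) k i
    have h2 := pow_le_pow_left₀ (norm_nonneg _) h1 2
    nlinarith [sq_nonneg (‖fc g k 0‖ - ‖fc g k 1‖)]
  linarith [h 0, h 1]

/-- The Leray projection is invisible when tested against divergence-free fields, and so are
gradients. -/
lemma sum_lerayCoeffs_conj_mul {c d y : Coeffs} {k : Wave} {q : ℂ} (h0 : ∀ i, y 0 i = 0)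
    (hdiv : ∑ i, (k i : ℂ) * y k i = 0) (hc : ∀ i, c k i = (k i : ℂ) * q + d k i) :
    ∑ i, conj (lerayCoeffs c k i) * y k i = ∑ i, conj (d k i) * y k i := by
  by_cases hk : k = 0
  · subst hk
    simp [h0]
  · simp only [lerayCoeffs, if_neg hk, hc]
    rw [Fin.sum_univ_two] at hdiv ⊢
    simp only [Fin.sum_univ_two, map_sub, map_add, map_mul, map_div₀, map_intCast,
      Complex.conj_ofReal]
    linear_combination (conj q - (((k 0 : ℂ) * (k 0 * conj q + conj (d k 0)) +
      (k 1 : ℂ) * (k 1 * conj q + conj (d k 1))) / (waveSq k : ℂ))) * hdiv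

/-- Mode by mode, both the Leray correction and the gradient part of `(u·∇)u` are parallel to `k`,
hence orthogonal to `y`; the Lamb vector remains. -/
lemma inner_B_self {u y : L2} (hu : Sob 2 u) (h0 : ∀ i, fc u 0 i = 0) (hy : y ∈ Lσ) :
    inner ℝ (B u u) y = ∫ x, vort u x * (u x 0 * y x 1 - u x 1 * y x 0) := by
  have hl := memLp_lamb hu h0
  have e : inner ℝ (B u u) y = inner ℝ (hl.toLp (lamb u)) y := by
    refine (hasSum_modeInner _ _).unique ((hasSum_modeInner _ _).congr_fun fun k => ?_)
    unfold modeInner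
    congr 1
    rw [← Complex.re_sum, ← Complex.re_sum]
    congr 1
    unfold B
    simp only [fc_leray (memLp_advect u hu h0), fc_congr hl.coeFn_toLp]
    exact sum_lerayCoeffs_conj_mul hy.1 (hy.2 k) (fc_advect_self (hu.mono one_le_two) k)
  rw [e, L2.inner_def]
  apply integral_congr_ae
  filter_upwards [hl.coeFn_toLp] with x hx
  rw [hx]
  simp only [PiLp.inner_apply, RCLike.inner_apply, conj_trivial, Fin.sum_univ_two, lamb]
  simp
  ring

/-- The vorticity is transported: `∫ ω_w v^⊥·Aw = 0`. -/
lemma integral_vort_transport {v w : L2} (hv : Sob 2 v) (hvσ : v ∈ Lσ) (hw : Sob 2 w)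
    (hwσ : w ∈ Lσ) :
    ∫ x, vort w x * (v x 0 * stokesPow 2 w x 1 - v x 1 * stokesPow 2 w x 0) = 0 := by
  set y := stokesPow 2 w with hy
  set om : Torus → ℂ := fun x => (vort w x : ℂ) with hom
  have hw1 := hw.mono one_le_two
  have hω : MemLp om 2 := memLp_ofReal (memLp_vort w)
  have hdiv : ∀ k : Wave, (k 0 : ℂ) * fc w k 0 + k 1 * fc w k 1 = 0 := fun k => by
    simpa [Fin.sum_univ_two] using hwσ.2 k
  have hW : ∀ k : Wave, (waveSq k : ℂ) = (k 0 : ℂ) ^ 2 + (k 1 : ℂ) ^ 2 := fun k => by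
    simp [waveSq]
  -- Since `w` is divergence-free, `Aw = (∂₁ω, -∂₀ω)`, with the coordinates numbered `0` and `1`.
  have d1 : ∀ k : Wave, sc (fun x => ((y x 0 : ℝ) : ℂ)) k = Complex.I * (k 1 : ℂ) * sc om k := by
    intro k
    rw [← fc_eq_sc, hy, fc_stokesPow_two hw, hom, sc_vort hw1, hW]
    linear_combination ((k 0 : ℂ)) * hdiv k -
      ((k 1 : ℂ) * (k 0 * fc w k 1 - k 1 * fc w k 0)) * Complex.I_sq
  have d0 : ∀ k : Wave, sc (fun x => (-1 : ℂ) * ((y x 1 : ℝ) : ℂ)) k =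
      Complex.I * (k 0 : ℂ) * sc om k := by
    intro k
    rw [sc_const_mul, ← fc_eq_sc, hy, fc_stokesPow_two hw, hom, sc_vort hw1, hW]
    linear_combination (-(k 1 : ℂ)) * hdiv k -
      ((k 0 : ℂ) * (k 0 * fc w k 1 - k 1 * fc w k 0)) * Complex.I_sq
  -- The identity `2 ω ∂ω = ∂(ω²)`, stated for coefficients because `ω²` is only known to be
  -- integrable.
  have L1 := fun k => sc_leibniz hω hω (memLp_ccoord y 0) (memLp_ccoord y 0) 1 d1 d1 k
  have hy1 : MemLp (fun x => (-1 : ℂ) * ((y x 1 : ℝ) : ℂ)) 2 := (memLp_ccoord y 1).const_mul _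
  have L0 := fun k => sc_leibniz hω hω hy1 hy1 0 d0 d0 k
  have i1 : Integrable fun x => om x * ((y x 0 : ℝ) : ℂ) := hω.integrable_mul (memLp_ccoord y 0)
  have i0 : Integrable fun x => om x * ((-1 : ℂ) * ((y x 1 : ℝ) : ℂ)) := hω.integrable_mul hy1
  have S1 := hasSum_sc_mul_sc_neg (memLp_ccoord v 1) (summable_norm_fc hv hvσ.1 1) i1
  have S0 := hasSum_sc_mul_sc_neg (memLp_ccoord v 0) (summable_norm_fc hv hvσ.1 0) i0
  -- Each term of the paired series is a multiple of `k·v̂(k)`, so it vanishes: this is `∫ v·∇(ω²) =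
  -- 0`.
  have hz := (S0.add S1).unique (hasSum_zero.congr_fun fun k => by
    have hd : (k 0 : ℂ) * fc v k 0 + k 1 * fc v k 1 = 0 := by
      simpa [Fin.sum_univ_two] using hvσ.2 k
    have h1 := L1 (-k)
    have h0 := L0 (-k)
    simp only [Pi.neg_apply, Int.cast_neg] at h0 h1
    rw [← fc_eq_sc, ← fc_eq_sc]
    linear_combination (1 / 2 * fc v k 0) * h0 + (1 / 2 * fc v k 1) * h1 -
      (1 / 2 * Complex.I * sc (fun x => om x * om x) (-k)) * hd)
  have hc : (((2 * Real.pi) ^ 2)⁻¹ : ℂ) ≠ 0 := by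
    apply inv_ne_zero
    apply pow_ne_zero
    exact_mod_cast Real.two_pi_pos.ne'
  rw [← mul_add] at hz
  have hz' := (mul_eq_zero.mp hz).resolve_left hc
  have j : ∀ (a : Fin 2) {g : Torus → ℝ}, MemLp g 2 →
      Integrable fun x => ((v x a : ℝ) : ℂ) * (om x * ((g x : ℝ) : ℂ)) := by
    intro a g hg
    have := (memLp_mul_coord hv hvσ.1 a (memLp_vort w)).integrable_mul hg
    refine this.ofReal.congr (Filter.Eventually.of_forall fun x => ?_)
    simp [hom]
    ring
  have j0 := (j 0 (memLp_coord (Lp.memLp y) 1)).neg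
  have j0' : Integrable fun x => ((v x 0 : ℝ) : ℂ) * (om x * ((-1 : ℂ) * ((y x 1 : ℝ) : ℂ))) :=
    j0.congr (Filter.Eventually.of_forall fun x => by simp)
  rw [← integral_add j0' (j 1 (memLp_coord (Lp.memLp y) 0))] at hz'
  have : ((∫ x, vort w x * (v x 0 * y x 1 - v x 1 * y x 0) : ℝ) : ℂ) = 0 := by
    rw [← integral_complex_ofReal, ← neg_eq_zero, ← integral_neg, ← hz']
    congr 1
    ext x
    simp [hom]
    ring
  exact_mod_cast this

lemma Lσ_sub {u v : L2} (hu : u ∈ Lσ) (hv : v ∈ Lσ) : u - v ∈ Lσ := by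
  refine ⟨fun i => by rw [fc_sub, hu.1, hv.1, sub_zero], fun k => ?_⟩
  simp only [fc_sub, mul_sub, Finset.sum_sub_distrib, hu.2 k, hv.2 k, sub_zero]

lemma stokesPow_mem_Lσ {m : ℕ} {u : L2} (h : Sob m u) (hu : u ∈ Lσ) : stokesPow m u ∈ Lσ := by
  refine ⟨fun i => by rw [fc_stokesPow h, hu.1, mul_zero], fun k => ?_⟩
  simp only [fc_stokesPow h, mul_left_comm _ ((Real.sqrt (waveSq k) ^ m : ℝ) : ℂ),
    ← Finset.mul_sum, hu.2 k, mul_zero]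

lemma integrable_sq_coord (u : L2) (i : Fin 2) : Integrable fun x => u x i ^ 2 :=
  (memLp_coord (Lp.memLp u) i).integrable_sq

lemma integrable_sq_add_sq (u : L2) : Integrable fun x => u x 0 ^ 2 + u x 1 ^ 2 :=
  (integrable_sq_coord u 0).add (integrable_sq_coord u 1)

lemma integral_sq_add_sq (u : L2) : ∫ x, u x 0 ^ 2 + u x 1 ^ 2 = ‖u‖ ^ 2 := by
  rw [← real_inner_self_eq_norm_sq, L2.inner_def]
  simp only [PiLp.inner_apply, RCLike.inner_apply, conj_trivial, Fin.sum_univ_two, pow_two]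

/-- The elementary bound `(a - b)² ≤ 2a² + 2b²` suffices; its factor `2` is absorbed by the
universal constants. -/
lemma integral_vort_sq_le {u : L2} (hu : Sob 1 u) :
    ∫ x, vort u x ^ 2 ≤ 2 * ‖stokesPow 1 u‖ ^ 2 := by
  rw [← norm_partialD_sq_add hu, ← integral_sq_add_sq, ← integral_sq_add_sq,
    ← integral_add (integrable_sq_add_sq _) (integrable_sq_add_sq _), ← integral_const_mul]
  refine integral_mono (memLp_vort u).integrable_sq
    (((integrable_sq_add_sq _).add (integrable_sq_add_sq _)).const_mul 2) fun x => ?_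
  simp only [vort]
  nlinarith [sq_nonneg (partialD 0 u x 1 + partialD 1 u x 0), sq_nonneg (partialD 0 u x 0),
    sq_nonneg (partialD 1 u x 1)]

/-- Advection produces no enstrophy in two dimensions: the transport identity with `v = w = u`. -/
lemma inner_B_stokes_self {u : L2} (hu : Sob 2 u) (huσ : u ∈ Lσ) :
    inner ℝ (B u u) (stokesPow 2 u) = 0 := by
  rw [inner_B_self hu huσ.1 (stokesPow_mem_Lσ hu huσ)]
  exact integral_vort_transport hu huσ hu huσ

/-- The trilinear estimate behind the algorithm. -/
lemma abs_inner_B_sub_le {u v : L2} (hu : Sob 2 u) (huσ : u ∈ Lσ) (hv : Sob 2 v) (hvσ : v ∈ Lσ)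
    {ε : ℝ} (hε : 0 < ε) :
    |inner ℝ (B v v - B u u) (stokesPow 2 (v - u))| ≤ ε * ‖stokesPow 2 (v - u)‖ ^ 2 +
      sobolevConst * fracSq (v - u) / (2 * ε) * ‖stokesPow 1 u‖ ^ 2 := by
  have hw := hv.sub hu
  have hwσ := Lσ_sub hvσ huσ
  have hyσ := stokesPow_mem_Lσ hw hwσ
  set w := v - u with hwdef
  set y := stokesPow 2 w with hy
  set W := sobolevConst * fracSq w with hW
  have hu1 := hu.mono one_le_two
  have hv1 := hv.mono one_le_two
  have hyi : ∀ i, MemLp (fun x => y x i) 2 := fun i => memLp_coord (Lp.memLp y) i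
  have hint : ∀ {z : L2} (o : L2), Sob 2 z → z ∈ Lσ →
      Integrable fun x => vort o x * (z x 0 * y x 1 - z x 1 * y x 0) := fun o hz hzσ =>
    (memLp_vort o).integrable_mul
      ((memLp_mul_coord hz hzσ.1 0 (hyi 1)).sub (memLp_mul_coord hz hzσ.1 1 (hyi 0)))
  -- The vanishing transport term `ω_w v^⊥·y` is subtracted: `ω_v v - ω_u u - ω_w v = ω_u w`.
  have e : inner ℝ (B v v - B u u) y = ∫ x, vort u x * (w x 0 * y x 1 - w x 1 * y x 0) := by
    rw [inner_sub_left, inner_B_self hv hvσ.1 hyσ, inner_B_self hu huσ.1 hyσ,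
      ← integral_sub (hint v hv hvσ) (hint u hu huσ),
      ← zero_add (∫ x, vort u x * (w x 0 * y x 1 - w x 1 * y x 0)),
      ← integral_vort_transport hv hvσ hw hwσ, ← hy,
      ← integral_add (hint w hv hvσ) (hint u hw hwσ)]
    apply integral_congr_ae
    have hd := fun j => partialD_sub hv1 hu1 j
    filter_upwards [Lp.coeFn_sub v u, Lp.coeFn_sub (partialD 0 v) (partialD 0 u),
      Lp.coeFn_sub (partialD 1 v) (partialD 1 u)] with x h1 h2 h3
    simp only [vort, hwdef, hd, h1, h2, h3]
    simp
    ring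
  have hb : ∀ᵐ x, ‖vort u x * (w x 0 * y x 1 - w x 1 * y x 0)‖ ≤
      ε * (y x 0 ^ 2 + y x 1 ^ 2) + W / (4 * ε) * vort u x ^ 2 := by
    filter_upwards [sq_add_sq_le_fracSq hw hwσ.1] with x hx
    -- Lagrange's identity `(w^⊥·y)² + (w·y)² = |w|²|y|²`, combined with the sup bound for `w`.
    have h0 : (w x 0 * y x 1 - w x 1 * y x 0) ^ 2 ≤ W * (y x 0 ^ 2 + y x 1 ^ 2) := by
      nlinarith [sq_nonneg (w x 0 * y x 0 + w x 1 * y x 1),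
        mul_le_mul_of_nonneg_right hx (add_nonneg (sq_nonneg (y x 0)) (sq_nonneg (y x 1)))]
    set q := w x 0 * y x 1 - w x 1 * y x 0
    set Y := y x 0 ^ 2 + y x 1 ^ 2 with hY
    have hY0 : 0 ≤ Y := by positivity
    have hW0 : 0 ≤ W := le_trans (by positivity) hx
    rw [Real.norm_eq_abs]
    apply abs_le_of_sq_le_sq
    · have h1 : (vort u x * q) ^ 2 ≤ vort u x ^ 2 * (W * Y) := by
        rw [mul_pow]
        gcongr
      have h2 : (ε * Y + W / (4 * ε) * vort u x ^ 2) ^ 2 =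
          (ε * Y - W / (4 * ε) * vort u x ^ 2) ^ 2 + vort u x ^ 2 * (W * Y) := by
        field_simp
        ring
      nlinarith [sq_nonneg (ε * Y - W / (4 * ε) * vort u x ^ 2)]
    · positivity
  rw [e, ← Real.norm_eq_abs]
  refine (norm_integral_le_integral_norm _).trans ?_
  have hi1 := (integrable_sq_add_sq y).const_mul ε
  have hi2 := (memLp_vort u).integrable_sq.const_mul (W / (4 * ε))
  have hW0 : 0 ≤ W := mul_nonneg sobolevConst_nonneg (tsum_nonneg fun k =>
    mul_nonneg (Real.rpow_nonneg (waveSq_nonneg k) _) (modeSq_nonneg _ _))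
  calc ∫ x, ‖vort u x * (w x 0 * y x 1 - w x 1 * y x 0)‖
      ≤ ∫ x, ε * (y x 0 ^ 2 + y x 1 ^ 2) + W / (4 * ε) * vort u x ^ 2 :=
        integral_mono_ae (hint u hw hwσ).norm (hi1.add hi2) hb
    _ = ε * ‖y‖ ^ 2 + W / (4 * ε) * ∫ x, vort u x ^ 2 := by
        rw [← integral_sq_add_sq y, ← integral_const_mul, ← integral_const_mul]
        exact integral_add hi1 hi2
    _ ≤ ε * ‖y‖ ^ 2 + W / (4 * ε) * (2 * ‖stokesPow 1 u‖ ^ 2) := by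
        gcongr
        exact integral_vort_sq_le hu1
    _ = _ := by field_simp; ring

/-! ### Interpolation and the differential inequalities for the enstrophy. -/

lemma norm_stokesPow_one_le_two {u : L2} (hu : Sob 2 u) :
    ‖stokesPow 1 u‖ ^ 2 ≤ ‖stokesPow 2 u‖ ^ 2 := by
  refine hasSum_le (fun k => ?_) (hasSum_stokesPow (hu.mono one_le_two)) (hasSum_stokesPow hu)
  by_cases hk : k = 0
  · simp [hk, waveSq_zero]
  · have := one_le_waveSq hk
    exact mul_le_mul_of_nonneg_right (pow_le_pow_right₀ this one_le_two) (modeSq_nonneg u k)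

/-- The low modes and the viscosity together damp the gradient at the rate `μ`. -/
lemma dissipation_le {w : L2} (hw : Sob 2 w) {ν μ : ℝ} {N : ℕ} (hν : 0 < ν) (hμ : 0 < μ)
    (hN : μ ≤ ν * (N : ℝ) ^ 2) :
    3 / 4 * μ * ‖stokesPow 1 w‖ ^ 2 + 1 / 4 * ν * ‖stokesPow 2 w‖ ^ 2 ≤
      ν * ‖stokesPow 2 w‖ ^ 2 + μ * inner ℝ (lowModes N w) (stokesPow 2 w) := by
  have h1 := hasSum_stokesPow (hw.mono one_le_two)
  have h2 := hasSum_stokesPow hw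
  have h3 := hasSum_modeInner (lowModes N w) (stokesPow 2 w)
  refine hasSum_le (fun k => ?_) ((h1.mul_left (3 / 4 * μ)).add (h2.mul_left (1 / 4 * ν)))
    ((h2.mul_left ν).add (h3.mul_left μ))
  have hE := modeSq_nonneg w k
  have hk0 := waveSq_nonneg k
  have e : modeInner (lowModes N w) (stokesPow 2 w) k =
      if waveSq k ≤ (N : ℝ) ^ 2 then waveSq k * modeSq w k else 0 := by
    unfold modeInner
    simp only [fc_lowModes, fc_stokesPow_two hw, trunc]
    split_ifs
    · simp only [mul_left_comm _ (waveSq k : ℂ), ← Complex.normSq_eq_conj_mul_self,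
        ← Complex.ofReal_mul, Complex.ofReal_re, Complex.normSq_eq_norm_sq, ← Finset.mul_sum,
        modeSq]
      ring
    · simp
  rw [e]
  split_ifs with h
  · have : 0 ≤ ν * (waveSq k ^ 2 * modeSq w k) := by positivity
    have : 0 ≤ μ * (waveSq k * modeSq w k) := by positivity
    linarith
  -- On high modes three quarters of the viscosity pay for the damping, because `μ ≤ νN² ≤ ν|k|²`.
  · push Not at h
    have h4 : μ ≤ ν * waveSq k := hN.trans (by gcongr)
    have := mul_le_mul_of_nonneg_right h4 (mul_nonneg hk0 hE)
    nlinarith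

/-- The constant in the interpolation inequality `fracSq_interpolation`. -/
def interpConst : ℝ := 8 * sobolevConst * (128 * sobolevConst + 1)

/-- With `a = |k|^{2/3}` the three weights are `a⁴`, `a⁶` and `a³`, so per mode the claim is a Young
inequality between `G²a`, `a³` and `G³`. The Sobolev exponent `4/3` is the one that yields the power
`G³`. -/
lemma fracSq_interpolation {w : L2} (hw : Sob 2 w) {G : ℝ} (hG : 0 ≤ G) :
    8 * sobolevConst * G ^ 2 * fracSq w ≤
      1 / 16 * ‖stokesPow 2 w‖ ^ 2 + interpConst * G ^ 3 * ‖stokesPow 1 w‖ ^ 2 := by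
  refine hasSum_le (fun k => ?_) ((summable_fracSq hw).hasSum.mul_left _)
    (((hasSum_stokesPow hw).mul_left _).add
      ((hasSum_stokesPow (hw.mono one_le_two)).mul_left _))
  set a := waveSq k ^ (1 / 3 : ℝ) with ha
  have hk0 := waveSq_nonneg k
  have ha0 : 0 ≤ a := Real.rpow_nonneg hk0 _
  have h3 : waveSq k = a ^ 3 := by
    rw [ha, ← Real.rpow_natCast, ← Real.rpow_mul hk0]
    norm_num
  have h4 : waveSq k ^ (4 / 3 : ℝ) = a ^ 4 := by
    rw [ha, ← Real.rpow_natCast (waveSq k ^ (1 / 3 : ℝ)), ← Real.rpow_mul hk0]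
    norm_num
  have hS := sobolevConst_nonneg
  set S := sobolevConst with hSdef
  have key : 8 * S * G ^ 2 * a ≤ 1 / 16 * a ^ 3 + interpConst * G ^ 3 := by
    rw [interpConst, ← hSdef]
    -- For small `a` the term `G³` dominates; for large `a` one has `128 S G² ≤ a²`, so the cubic
    -- term dominates.
    rcases le_or_gt a ((128 * S + 1) * G) with h | h
    · have := mul_le_mul_of_nonneg_left h (show 0 ≤ 8 * S * G ^ 2 by positivity)
      nlinarith [show 0 ≤ a ^ 3 by positivity]
    · have h5 : ((128 * S + 1) * G) ^ 2 ≤ a ^ 2 := by gcongr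
      have h6 : 128 * S * G ^ 2 ≤ a ^ 2 := by
        refine le_trans ?_ h5
        have : 128 * S ≤ (128 * S + 1) ^ 2 := by nlinarith [mul_nonneg hS hS]
        rw [mul_pow]
        gcongr
      have := mul_le_mul_of_nonneg_right h6 ha0
      have : 0 ≤ 8 * S * (128 * S + 1) * G ^ 3 := by positivity
      nlinarith
  have hE := modeSq_nonneg w k
  rw [h4, h3]
  have := mul_le_mul_of_nonneg_right key (show 0 ≤ a ^ 3 * modeSq w k by positivity)
  nlinarith

lemma inner_le_mul_sq {g y : L2} {a b : ℝ} (ha : 0 < a) (hab : 1 / 4 ≤ a * b) :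
    inner ℝ g y ≤ a * ‖y‖ ^ 2 + b * ‖g‖ ^ 2 := by
  refine (real_inner_le_norm g y).trans ?_
  have hb : 1 / (4 * a) ≤ b := by
    rw [div_le_iff₀ (by positivity)]
    linarith
  have h1 := mul_le_mul_of_nonneg_right hb (sq_nonneg ‖g‖)
  have h2 : 0 ≤ a * (‖y‖ - ‖g‖ / (2 * a)) ^ 2 := by positivity
  have h3 : a * (‖y‖ - ‖g‖ / (2 * a)) ^ 2 =
      a * ‖y‖ ^ 2 - ‖g‖ * ‖y‖ + 1 / (4 * a) * ‖g‖ ^ 2 := by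
    field_simp
    ring
  linarith

/-- The differential inequality for the enstrophy of a solution. -/
lemma enstrophy_rate_le {u u' f : L2} (hu : Sob 2 u) (huσ : u ∈ Lσ) {ν : ℝ} (hν : 0 < ν)
    (h : u' + ν • stokesPow 2 u + B u u = f) :
    2 * inner ℝ u' (stokesPow 2 u) ≤ -ν * ‖stokesPow 1 u‖ ^ 2 + 1 / ν * ‖f‖ ^ 2 := by
  have e : u' = f - ν • stokesPow 2 u - B u u := by rw [← h]; abel
  have h1 : inner ℝ f (stokesPow 2 u) ≤ ν / 2 * ‖stokesPow 2 u‖ ^ 2 + 1 / (2 * ν) * ‖f‖ ^ 2 :=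
    inner_le_mul_sq (by positivity) (le_of_eq (by field_simp; norm_num))
  have h2 := mul_le_mul_of_nonneg_left (norm_stokesPow_one_le_two hu) hν.le
  rw [e, inner_sub_left, inner_sub_left, real_inner_smul_left, real_inner_self_eq_norm_sq,
    inner_B_stokes_self hu huσ]
  have : 2 * (1 / (2 * ν) * ‖f‖ ^ 2) = 1 / ν * ‖f‖ ^ 2 := by field_simp
  linarith

/-- The differential inequality for the enstrophy of the synchronisation error. -/
lemma error_rate_le {u v w' g : L2} (hu : Sob 2 u) (huσ : u ∈ Lσ) (hv : Sob 2 v) (hvσ : v ∈ Lσ)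
    {ν μ G : ℝ} {N : ℕ} (hν : 0 < ν) (hμ : 0 < μ) (hG : 0 ≤ G)
    (hN : μ ≤ ν * (N : ℝ) ^ 2) (hμG : 4 * interpConst * G ^ 3 * ν ≤ μ)
    (hgrad : ‖stokesPow 1 u‖ ≤ ν * G)
    (h : w' + ν • stokesPow 2 (v - u) + (B v v - B u u) = g - μ • lowModes N (v - u)) :
    2 * inner ℝ w' (stokesPow 2 (v - u)) ≤
      -μ * ‖stokesPow 1 (v - u)‖ ^ 2 + 4 / ν * ‖g‖ ^ 2 := by
  have hw := hv.sub hu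
  -- The value `ε = ν/16` makes the budget close: `ν/8` for `g`, `ν/16` here and `ν/16` after
  -- interpolation use up the `ν/4` left by `dissipation_le`. Of the damping `3μ/4`, a part `μ/4` is
  -- spent and `μ/2` remains, doubled to `μ` by the factor `2`.
  have hnl := abs_inner_B_sub_le hu huσ hv hvσ (ε := ν / 16) (by positivity)
  set w := v - u
  have e : w' = g - μ • lowModes N w - ν • stokesPow 2 w - (B v v - B u u) := by
    rw [← h]; abel
  have h1 : inner ℝ g (stokesPow 2 w) ≤ ν / 8 * ‖stokesPow 2 w‖ ^ 2 + 2 / ν * ‖g‖ ^ 2 :=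
    inner_le_mul_sq (by positivity) (le_of_eq (by field_simp; norm_num))
  have h2 := dissipation_le hw hν hμ hN
  have h3 : sobolevConst * fracSq w / (2 * (ν / 16)) * ‖stokesPow 1 u‖ ^ 2 ≤
      ν / 16 * ‖stokesPow 2 w‖ ^ 2 + μ / 4 * ‖stokesPow 1 w‖ ^ 2 := by
    have hW0 : 0 ≤ sobolevConst * fracSq w := mul_nonneg sobolevConst_nonneg (tsum_nonneg fun k =>
      mul_nonneg (Real.rpow_nonneg (waveSq_nonneg k) _) (modeSq_nonneg _ _))
    calc sobolevConst * fracSq w / (2 * (ν / 16)) * ‖stokesPow 1 u‖ ^ 2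
        ≤ sobolevConst * fracSq w / (2 * (ν / 16)) * (ν * G) ^ 2 := by gcongr
      _ = ν * (8 * sobolevConst * G ^ 2 * fracSq w) := by field_simp; ring
      _ ≤ ν * (1 / 16 * ‖stokesPow 2 w‖ ^ 2 + interpConst * G ^ 3 * ‖stokesPow 1 w‖ ^ 2) := by
          gcongr
          exact fracSq_interpolation hw hG
      _ ≤ _ := by nlinarith [mul_le_mul_of_nonneg_right hμG (sq_nonneg ‖stokesPow 1 w‖)]
  have h4 := neg_le_of_abs_le hnl
  rw [e, inner_sub_left, inner_sub_left, inner_sub_left, real_inner_smul_left,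
    real_inner_smul_left, real_inner_self_eq_norm_sq]
  have : 2 * (2 / ν * ‖g‖ ^ 2) = 4 / ν * ‖g‖ ^ 2 := by ring
  linarith

open Filter Topology

/-! ### Absolutely continuous functions and Gronwall's inequality. -/

section Calculus

/-- An indefinite integral is absolutely continuous, so the product rule integrates. The auxiliary
`Φ` is defined on the whole line and agrees with `φ` on `[a,b]`. -/
lemma sq_sub_sq_eq_integral {φ φ' : ℝ → ℝ} {a b : ℝ} (hab : a ≤ b)
    (hi : IntervalIntegrable φ' volume a b)
    (h : ∀ t ∈ Icc a b, φ t = φ a + ∫ s in a..t, φ' s) :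
    φ b ^ 2 - φ a ^ 2 = ∫ s in a..b, 2 * (φ s * φ' s) := by
  set Φ : ℝ → ℝ := fun t => φ a + ∫ s in a..t, φ' s with hΦ
  have hac : AbsolutelyContinuousOnInterval Φ a b := by
    have h1 : AbsolutelyContinuousOnInterval (fun _ : ℝ => φ a) a b :=
      (LipschitzWith.const (φ a)).lipschitzOnWith.absolutelyContinuousOnInterval (K := 0)
    exact h1.fun_add (hi.absolutelyContinuousOnInterval_intervalIntegral (by simp))
  have h1 := hac.integral_deriv_mul_eq_sub hac
  have hd : ∀ᵐ x, x ∈ uIcc a b → HasDerivAt Φ (φ' x) x := by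
    filter_upwards [hi.ae_hasDerivAt_integral] with x hx hxm
    exact (hx hxm a (by simp)).const_add _
  have e1 : Φ b = φ b := (h b ⟨hab, le_rfl⟩).symm
  have e0 : Φ a = φ a := by simp [hΦ]
  rw [e1, e0] at h1
  rw [pow_two, pow_two, ← h1]
  apply intervalIntegral.integral_congr_ae
  filter_upwards [hd] with x hx hxm
  rw [(hx (uIoc_subset_uIcc hxm)).deriv]
  rw [uIoc_of_le hab] at hxm
  have : Φ x = φ x := (h x ⟨hxm.1.le, hxm.2⟩).symm
  rw [this]
  ring

lemma norm_sq_sub_norm_sq_eq_integral {ψ ψ' : ℝ → ℂ} {a b : ℝ} (hab : a ≤ b)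
    (hi : IntervalIntegrable ψ' volume a b)
    (h : ∀ t ∈ Icc a b, ψ t = ψ a + ∫ s in a..t, ψ' s) :
    ‖ψ b‖ ^ 2 - ‖ψ a‖ ^ 2 = ∫ s in a..b, 2 * (conj (ψ' s) * ψ s).re := by
  have hsub : ∀ t ∈ Icc a b, IntervalIntegrable ψ' volume a t := fun t ht =>
    hi.mono_set (uIcc_subset_uIcc_left (by rw [uIcc_of_le hab]; exact ht))
  have hr : IntervalIntegrable (fun s => (ψ' s).re) volume a b :=
    ⟨hi.1.re, hi.2.re⟩
  have hm : IntervalIntegrable (fun s => (ψ' s).im) volume a b :=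
    ⟨hi.1.im, hi.2.im⟩
  have h1 := sq_sub_sq_eq_integral (φ := fun t => (ψ t).re) hab hr fun t ht => by
    have := Complex.reCLM.intervalIntegral_comp_comm (hsub t ht)
    simp only [Complex.reCLM_apply] at this
    rw [this, h t ht, Complex.add_re]
  have h2 := sq_sub_sq_eq_integral (φ := fun t => (ψ t).im) hab hm fun t ht => by
    have := Complex.imCLM.intervalIntegral_comp_comm (hsub t ht)
    simp only [Complex.imCLM_apply] at this
    rw [this, h t ht, Complex.add_im]
  have hc : ContinuousOn ψ (uIcc a b) := by
    rw [uIcc_of_le hab]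
    refine ContinuousOn.congr ?_ h
    have := (intervalIntegral.continuousOn_primitive_interval' hi left_mem_uIcc)
    rw [uIcc_of_le hab] at this
    exact continuousOn_const.add this
  have i1 : IntervalIntegrable (fun s => 2 * ((ψ s).re * (ψ' s).re)) volume a b :=
    (hr.continuousOn_mul (Complex.continuous_re.comp_continuousOn hc)).const_mul 2
  have i2 : IntervalIntegrable (fun s => 2 * ((ψ s).im * (ψ' s).im)) volume a b :=
    (hm.continuousOn_mul (Complex.continuous_im.comp_continuousOn hc)).const_mul 2
  have e : ∀ z : ℂ, ‖z‖ ^ 2 = z.re ^ 2 + z.im ^ 2 := fun z => by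
    rw [← Complex.normSq_eq_norm_sq, Complex.normSq_apply]; ring
  calc ‖ψ b‖ ^ 2 - ‖ψ a‖ ^ 2 = ((ψ b).re ^ 2 - (ψ a).re ^ 2) + ((ψ b).im ^ 2 - (ψ a).im ^ 2) := by
        rw [e, e]; ring
    _ = _ := by
        rw [h1, h2, ← intervalIntegral.integral_add i1 i2]
        congr 1
        ext s
        simp
        ring

/-- Gronwall's inequality for a quantity that decays at the rate `r`. -/
lemma le_of_sub_le_integral {y : ℝ → ℝ} {a r K : ℝ} (hr : 0 < r)
    (hc : ContinuousOn y (Ici a))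
    (h : ∀ s t, a ≤ s → s ≤ t → y t - y s ≤ ∫ τ in s..t, (-r * y τ + K)) {t : ℝ} (ht : a ≤ t) :
    y t ≤ Real.exp (-r * (t - a)) * y a + K / r * (1 - Real.exp (-r * (t - a))) := by
  have hcI : ∀ b, ContinuousOn y (Icc a b) := fun b => hc.mono Icc_subset_Ici_self
  have hg : ContinuousOn (fun τ => -r * y τ + K) (Ici a) :=
    (continuousOn_const.mul hc).add continuousOn_const
  -- No differentiability of `y` is needed: right difference quotients suffice, and continuity of
  -- the integrand bounds them through `h`. The Gronwall constant `-r` is negative, which gives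
  -- decay.
  have key := le_gronwallBound_of_liminf_deriv_right_le (f := y) (f' := fun x => -r * y x + K)
    (δ := y a) (K := -r) (ε := K) (a := a) (b := t) (hcI t) (fun x hx q hq => ?_) le_rfl
    (fun x _ => le_rfl) t ⟨ht, le_rfl⟩
  · rw [gronwallBound_of_K_ne_0 (by linarith)] at key
    refine key.trans_eq ?_
    field_simp
    ring
  · obtain ⟨q', hq1, hq2⟩ := exists_between hq
    have hx' : ContinuousWithinAt (fun τ => -r * y τ + K) (Ici x) x :=
      (hg x hx.1).mono (Ici_subset_Ici.mpr hx.1)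
    have hev : ∀ᶠ τ in 𝓝[≥] x, -r * y τ + K < q' := hx'.eventually_lt_const hq1
    obtain ⟨d, hd, hsub⟩ := mem_nhdsGE_iff_exists_Ico_subset.mp hev
    apply Eventually.frequently
    filter_upwards [Ioo_mem_nhdsGT hd] with z hz
    have h1 : ∫ τ in x..z, (-r * y τ + K) ≤ ∫ _ in x..z, q' := by
      refine intervalIntegral.integral_mono_on hz.1.le ?_ (by simp) fun τ hτ => ?_
      · apply ContinuousOn.intervalIntegrable_of_Icc hz.1.le
        exact hg.mono fun τ hτ => hx.1.trans hτ.1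
      · exact (hsub ⟨hτ.1, hτ.2.trans_lt hz.2⟩ : _ < q').le
    have h2 := (h x z hx.1 hz.1.le).trans h1
    rw [intervalIntegral.integral_const, smul_eq_mul] at h2
    have h3 : 0 < z - x := sub_pos.mpr hz.1
    rw [inv_mul_lt_iff₀ h3]
    nlinarith

end Calculus

/-! ### Paths in the energy spaces and the enstrophy identity. -/

/-- `w` is a path on `[a,∞)` in the energy spaces of strong solutions, with time derivative
`w'`. -/
structure IsPath (a : ℝ) (w w' : ℝ → L2) : Prop where
  mem : ∀ t, a ≤ t → w t ∈ Lσ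
  sob_one : ∀ t, a ≤ t → Sob 1 (w t)
  cont : ContinuousOn (fun t => stokesPow 1 (w t)) (Ici a)
  sob_two : ∀ᵐ t ∂(volume.restrict (Ici a)), Sob 2 (w t)
  memLp_two : ∀ T : ℝ, MemLp (fun t => stokesPow 2 (w t)) 2 (volume.restrict (Icc a T))
  memLp_deriv : ∀ T : ℝ, MemLp w' 2 (volume.restrict (Icc a T))
  eq : ∀ s t, a ≤ s → s ≤ t → w t = w s + ∫ τ in s..t, w' τ

section Path

variable {a : ℝ} {w w' : ℝ → L2}

lemma ae_restrict_Icc {p : ℝ → Prop} (h : ∀ᵐ t ∂(volume.restrict (Ici a)), p t) {s : ℝ}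
    (hs : a ≤ s) (t : ℝ) : ∀ᵐ τ ∂(volume.restrict (Icc s t)), p τ :=
  ae_mono (Measure.restrict_mono (fun _ hτ => hs.trans hτ.1) le_rfl) h

lemma intervalIntegrable_of_memLp {E : Type*} [NormedAddCommGroup E] {g : ℝ → E}
    (h : ∀ T : ℝ, MemLp g 2 (volume.restrict (Icc a T))) {s t : ℝ} (hs : a ≤ s) (hst : s ≤ t) :
    IntervalIntegrable g volume s t := by
  rw [intervalIntegrable_iff_integrableOn_Icc_of_le hst]
  exact IntegrableOn.mono_set ((h t).integrable one_le_two) (Icc_subset_Icc_left hs)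

/-- The integral formula of a strong solution is based at `a`; additivity rebases it at any later
time, so that `u` can be restricted to the interval of a later stage. -/
lemma IsStrongSolution.isPath {ν : ℝ} {F u : ℝ → L2} (h : IsStrongSolution ν a F u) :
    ∃ u', IsPath a u u' ∧
      ∀ᵐ t ∂(volume.restrict (Ici a)), u' t + ν • stokesPow 2 (u t) + B (u t) (u t) = F t := by
  obtain ⟨u', h1, h2, h3⟩ := h.equation
  refine ⟨u', ⟨fun t ht => (h.mem_H1 t ht).1, fun t ht => sob_of_memH (h.mem_H1 t ht).2, h.cont_H1,
    ?_, h.memLp_H2, h1, fun s t hs hst => ?_⟩, h3⟩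
  · filter_upwards [h.mem_H2] with t ht using sob_of_memH ht.2
  · rw [h2 t (hs.trans hst), h2 s hs, add_assoc, intervalIntegral.integral_add_adjacent_intervals]
    · exact intervalIntegrable_of_memLp h1 le_rfl hs
    · exact intervalIntegrable_of_memLp h1 hs hst

lemma IsPath.mono {b : ℝ} (h : IsPath a w w') (hab : a ≤ b) : IsPath b w w' where
  mem t ht := h.mem t (hab.trans ht)
  sob_one t ht := h.sob_one t (hab.trans ht)
  cont := h.cont.mono (Ici_subset_Ici.mpr hab)
  sob_two := ae_mono (Measure.restrict_mono (Ici_subset_Ici.mpr hab) le_rfl) h.sob_two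
  memLp_two T := (h.memLp_two T).mono_measure
    (Measure.restrict_mono (Icc_subset_Icc_left hab) le_rfl)
  memLp_deriv T := (h.memLp_deriv T).mono_measure
    (Measure.restrict_mono (Icc_subset_Icc_left hab) le_rfl)
  eq s t hs hst := h.eq s t (hab.trans hs) hst

lemma IsPath.sub {v v' : ℝ → L2} (h : IsPath a v v') (hw : IsPath a w w') :
    IsPath a (fun t => v t - w t) (fun t => v' t - w' t) where
  mem t ht := Lσ_sub (h.mem t ht) (hw.mem t ht)
  sob_one t ht := (h.sob_one t ht).sub (hw.sob_one t ht)
  cont := (h.cont.sub hw.cont).congr fun t ht => stokesPow_sub (h.sob_one t ht) (hw.sob_one t ht)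
  sob_two := by filter_upwards [h.sob_two, hw.sob_two] with t h1 h2 using h1.sub h2
  memLp_two T := by
    refine ((h.memLp_two T).sub (hw.memLp_two T)).ae_eq ?_
    filter_upwards [ae_restrict_Icc h.sob_two le_rfl T, ae_restrict_Icc hw.sob_two le_rfl T]
      with t h1 h2 using (stokesPow_sub h1 h2).symm
  memLp_deriv T := (h.memLp_deriv T).sub (hw.memLp_deriv T)
  eq s t hs hst := by
    rw [intervalIntegral.integral_sub (intervalIntegrable_of_memLp h.memLp_deriv hs hst)
      (intervalIntegrable_of_memLp hw.memLp_deriv hs hst), h.eq s t hs hst, hw.eq s t hs hst]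
    abel

lemma IsPath.fc_eq (h : IsPath a w w') {s t : ℝ} (hs : a ≤ s) (hst : s ≤ t) (k : Wave)
    (i : Fin 2) : fc (w t) k i = fc (w s) k i + ∫ τ in s..t, fc (w' τ) k i := by
  have := (fcL k i).intervalIntegral_comp_comm (intervalIntegrable_of_memLp h.memLp_deriv hs hst)
  simp only [fcL_apply] at this
  rw [this, ← fc_add, ← h.eq s t hs hst]

lemma abs_modeInner_le (u v : L2) (k : Wave) : |modeInner u v k| ≤ modeSq u k + modeSq v k := by
  unfold modeInner modeSq
  rw [abs_mul, abs_of_nonneg (by positivity), ← mul_add, ← Finset.sum_add_distrib]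
  gcongr
  refine (Finset.abs_sum_le_sum_abs _ _).trans (Finset.sum_le_sum fun i _ => ?_)
  refine (Complex.abs_re_le_norm _).trans ?_
  rw [norm_mul, RCLike.norm_conj]
  nlinarith [sq_nonneg (‖fc u k i‖ - ‖fc v k i‖), sq_nonneg ‖fc u k i‖, sq_nonneg ‖fc v k i‖]

/-- Each coefficient of `w` is absolutely continuous, and the factor `|k|²` turns it into the
coefficient of `Aw` at the almost every time when `w` is in `H²`. -/
lemma IsPath.mode_eq (h : IsPath a w w') {s t : ℝ} (hs : a ≤ s) (hst : s ≤ t) (k : Wave) :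
    waveSq k ^ 1 * modeSq (w t) k - waveSq k ^ 1 * modeSq (w s) k =
      ∫ τ in s..t, 2 * modeInner (w' τ) (stokesPow 2 (w τ)) k := by
  have hi : ∀ i, IntervalIntegrable (fun τ => fc (w' τ) k i) volume s t := fun i =>
    intervalIntegrable_of_memLp (fun T => (fcL k i).comp_memLp' (h.memLp_deriv T)) hs hst
  have h1 : ∀ i, ‖fc (w t) k i‖ ^ 2 - ‖fc (w s) k i‖ ^ 2 =
      ∫ τ in s..t, 2 * (conj (fc (w' τ) k i) * fc (w τ) k i).re := fun i =>
    norm_sq_sub_norm_sq_eq_integral (ψ := fun τ => fc (w τ) k i) hst (hi i)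
      fun τ hτ => h.fc_eq hs hτ.1 k i
  have hii : ∀ i, IntervalIntegrable (fun τ => 2 * (conj (fc (w' τ) k i) * fc (w τ) k i).re)
      volume s t := fun i => by
    have hc : ContinuousOn (fun τ => fc (w τ) k i) (uIcc s t) := by
      rw [uIcc_of_le hst]
      refine ContinuousOn.congr ?_ fun τ hτ => h.fc_eq hs hτ.1 k i
      have := (intervalIntegral.continuousOn_primitive_interval' (hi i) left_mem_uIcc)
      rw [uIcc_of_le hst] at this
      exact continuousOn_const.add this
    have hcj : IntervalIntegrable (fun τ => conj (fc (w' τ) k i)) volume s t :=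
      ⟨Complex.conjCLE.toContinuousLinearMap.integrable_comp (hi i).1,
        Complex.conjCLE.toContinuousLinearMap.integrable_comp (hi i).2⟩
    have := hcj.mul_continuousOn hc
    exact IntervalIntegrable.const_mul ⟨this.1.re, this.2.re⟩ 2
  calc waveSq k ^ 1 * modeSq (w t) k - waveSq k ^ 1 * modeSq (w s) k
      = waveSq k * (2 * Real.pi) ^ 2 * ∑ i, (‖fc (w t) k i‖ ^ 2 - ‖fc (w s) k i‖ ^ 2) := by
        unfold modeSq
        rw [Finset.sum_sub_distrib]
        ring
    _ = ∫ τ in s..t, waveSq k * (2 * Real.pi) ^ 2 *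
          ∑ i, 2 * (conj (fc (w' τ) k i) * fc (w τ) k i).re := by
        simp only [h1]
        rw [← intervalIntegral.integral_finsetSum fun i _ => hii i,
          ← intervalIntegral.integral_const_mul]
    _ = _ := by
        apply intervalIntegral.integral_congr_ae_restrict
        rw [uIoc_of_le hst]
        have := ae_mono (Measure.restrict_mono Ioc_subset_Icc_self le_rfl)
          (ae_restrict_Icc h.sob_two hs t)
        filter_upwards [this] with τ hτ
        unfold modeInner
        simp only [fc_stokesPow_two hτ, mul_left_comm _ (waveSq k : ℂ), Complex.re_ofReal_mul,
          ← Finset.mul_sum]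
        ring

lemma IsPath.integrable_inner (h : IsPath a w w') (T : ℝ) :
    Integrable (fun τ => 2 * inner ℝ (w' τ) (stokesPow 2 (w τ))) (volume.restrict (Icc a T)) := by
  refine Integrable.const_mul ?_ 2
  refine (((h.memLp_deriv T).integrable_norm_pow two_ne_zero).add
    ((h.memLp_two T).integrable_norm_pow two_ne_zero)).mono'
    ((h.memLp_deriv T).1.inner (h.memLp_two T).1) (Eventually.of_forall fun τ => ?_)
  rw [Real.norm_eq_abs]
  refine (abs_real_inner_le_norm _ _).trans ?_
  simp only [Pi.add_apply]
  nlinarith [sq_nonneg (‖w' τ‖ - ‖stokesPow 2 (w τ)‖), sq_nonneg ‖w' τ‖,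
    sq_nonneg ‖stokesPow 2 (w τ)‖]

/-- The enstrophy identity. -/
lemma IsPath.enstrophy_eq (h : IsPath a w w') {s t : ℝ} (hs : a ≤ s) (hst : s ≤ t) :
    ‖stokesPow 1 (w t)‖ ^ 2 - ‖stokesPow 1 (w s)‖ ^ 2 =
      ∫ τ in s..t, 2 * inner ℝ (w' τ) (stokesPow 2 (w τ)) := by
  have h' := h.mono hs
  have hl := (hasSum_stokesPow (h.sob_one t (hs.trans hst))).sub
    (hasSum_stokesPow (h.sob_one s hs))
  have hm : ∀ k : Wave, AEStronglyMeasurable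
      (fun τ => 2 * modeInner (w' τ) (stokesPow 2 (w τ)) k) (volume.restrict (Icc s t)) := by
    intro k
    unfold modeInner
    refine AEStronglyMeasurable.const_mul (AEStronglyMeasurable.const_mul ?_ _) _
    refine Finset.aestronglyMeasurable_fun_sum _ fun i _ => ?_
    refine Complex.continuous_re.comp_aestronglyMeasurable (AEStronglyMeasurable.mul ?_ ?_)
    · exact Complex.continuous_conj.comp_aestronglyMeasurable
        ((fcL k i).continuous.comp_aestronglyMeasurable (h'.memLp_deriv t).1)
    · exact (fcL k i).continuous.comp_aestronglyMeasurable (h'.memLp_two t).1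
  have hS := fun τ => ((hasSum_modeSq (w' τ)).add (hasSum_modeSq (stokesPow 2 (w τ)))).mul_left 2
  -- The dominating series sums to `2(‖w'‖² + ‖Aw‖²)`, which is integrable in time.
  have hr := hasSum_integral_of_dominated_convergence (μ := volume.restrict (Icc s t))
    (F := fun k τ => 2 * modeInner (w' τ) (stokesPow 2 (w τ)) k)
    (f := fun τ => 2 * inner ℝ (w' τ) (stokesPow 2 (w τ)))
    (fun k τ => 2 * (modeSq (w' τ) k + modeSq (stokesPow 2 (w τ)) k)) hm
    (fun k => Eventually.of_forall fun τ => by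
      rw [Real.norm_eq_abs, abs_mul, abs_two]
      have := abs_modeInner_le (w' τ) (stokesPow 2 (w τ)) k
      linarith)
    (Eventually.of_forall fun τ => (hS τ).summable)
    (by
      simp only [(hS _).tsum_eq]
      exact (((h'.memLp_deriv t).integrable_norm_pow two_ne_zero).add
        ((h'.memLp_two t).integrable_norm_pow two_ne_zero)).const_mul 2)
    (Eventually.of_forall fun τ => (hasSum_modeInner _ _).mul_left 2)
  refine hl.unique ?_
  rw [intervalIntegral.integral_of_le hst, ← integral_Icc_eq_integral_Ioc]
  refine hr.congr_fun fun k => ?_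
  rw [h.mode_eq hs hst, intervalIntegral.integral_of_le hst, ← integral_Icc_eq_integral_Ioc]

/-- Exponential decay of the enstrophy from its differential inequality. -/
lemma IsPath.enstrophy_le (h : IsPath a w w') {r K : ℝ} (hr : 0 < r)
    (hd : ∀ᵐ τ ∂(volume.restrict (Ici a)),
      2 * inner ℝ (w' τ) (stokesPow 2 (w τ)) ≤ -r * ‖stokesPow 1 (w τ)‖ ^ 2 + K)
    {t : ℝ} (ht : a ≤ t) :
    ‖stokesPow 1 (w t)‖ ^ 2 ≤ Real.exp (-r * (t - a)) * ‖stokesPow 1 (w a)‖ ^ 2 +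
      K / r * (1 - Real.exp (-r * (t - a))) := by
  have hc : ContinuousOn (fun t => ‖stokesPow 1 (w t)‖ ^ 2) (Ici a) := h.cont.norm.pow 2
  refine le_of_sub_le_integral (y := fun t => ‖stokesPow 1 (w t)‖ ^ 2) hr hc
    (fun s t hs hst => ?_) ht
  rw [h.enstrophy_eq hs hst]
  refine intervalIntegral.integral_mono_ae_restrict hst ?_ ?_ (ae_restrict_Icc hd hs t)
  · rw [intervalIntegrable_iff_integrableOn_Icc_of_le hst]
    exact (h.mono hs).integrable_inner t
  · apply ContinuousOn.intervalIntegrable_of_Icc hst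
    exact ((continuousOn_const.mul hc).add continuousOn_const).mono fun τ hτ => hs.trans hτ.1

end Path

/-! ### Bounds for trigonometric polynomials and for the reconstructed state. -/

section LowModes

variable {N : ℕ} {c : Coeffs}

/-- A finite set containing all wave vectors with `|k| ≤ N`. -/
def waveBox (N : ℕ) : Finset Wave := Fintype.piFinset fun _ => Finset.Icc (-(N : ℤ)) N

lemma mem_waveBox {k : Wave} (h : waveSq k ≤ (N : ℝ) ^ 2) : k ∈ waveBox N := by
  rw [waveBox, Fintype.mem_piFinset]
  intro i
  have h1 : (k i : ℝ) ^ 2 ≤ (N : ℝ) ^ 2 := by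
    refine le_trans ?_ h
    fin_cases i <;> simp [waveSq] <;> positivity
  have h2 : (k i) ^ 2 ≤ (N : ℤ) ^ 2 := by exact_mod_cast h1
  rw [Finset.mem_Icc]
  exact abs_le.mp (abs_le_of_sq_le_sq h2 (by positivity))

/-- A bound for the square norm of trigonometric polynomials of degree `N` whose coefficients are
at most `K`. -/
def polyBound (N : ℕ) (K : ℝ) : ℝ := (waveBox N).card * ((2 * Real.pi) ^ 2 * (2 * K ^ 2))

lemma sum_trunc_le {K : ℝ} (h : ∀ k, waveSq k ≤ (N : ℝ) ^ 2 → ∀ i, ‖c k i‖ ≤ K) :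
    ∃ S, 0 ≤ S ∧ S ≤ polyBound N K ∧
      HasSum (fun k => (2 * Real.pi) ^ 2 * ∑ i, ‖trunc N c k i‖ ^ 2) S := by
  refine ⟨_, ?_, ?_, hasSum_sum_of_ne_finset_zero (s := waveBox N) fun k hk => ?_⟩
  · exact Finset.sum_nonneg fun k _ => by positivity
  · rw [polyBound, ← nsmul_eq_mul]
    refine Finset.sum_le_card_nsmul _ _ _ fun k _ => ?_
    gcongr
    unfold trunc
    split_ifs with hk
    · rw [Fin.sum_univ_two, two_mul]
      gcongr
      · exact h k hk 0
      · exact h k hk 1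
    · simp; positivity
  · have : ¬ waveSq k ≤ (N : ℝ) ^ 2 := fun h' => hk (mem_waveBox h')
    simp [trunc, this]

lemma norm_ofFourier_trunc_sq_le {K : ℝ}
    (h : ∀ k, waveSq k ≤ (N : ℝ) ^ 2 → ∀ i, ‖c k i‖ ≤ K) :
    ‖ofFourier (trunc N c)‖ ^ 2 ≤ polyBound N K := by
  obtain ⟨S, h0, h1, h2⟩ := sum_trunc_le h
  exact (norm_ofFourier_sq_le h0 h2).trans h1

lemma norm_sq_le_of_fc {x : L2} {K : ℝ}
    (h : ∀ k, waveSq k ≤ (N : ℝ) ^ 2 → ∀ i, ‖fc x k i‖ ≤ K)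
    (h0 : ∀ k, ¬ waveSq k ≤ (N : ℝ) ^ 2 → ∀ i, fc x k i = 0) : ‖x‖ ^ 2 ≤ polyBound N K := by
  obtain ⟨S, -, h1, h2⟩ := sum_trunc_le h
  have e : ∀ k i, trunc N (fc x) k i = fc x k i := fun k i => by
    unfold trunc
    split_ifs with hk
    · rfl
    · exact (h0 k hk i).symm
  simp only [e] at h2
  exact ((hasSum_modeSq x).unique h2).trans_le h1

lemma norm_fc_le_norm (u : L2) (k : Wave) (i : Fin 2) : ‖fc u k i‖ ≤ ‖u‖ := by
  refine (norm_fc_le u k i).trans (mul_le_of_le_one_left (norm_nonneg u) ?_)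
  exact inv_le_one_of_one_le₀ (by linarith [Real.pi_gt_three])

lemma norm_stokesPow_lowModes_sq_le (u : L2) :
    ‖stokesPow 2 (lowModes N u)‖ ^ 2 ≤ polyBound N ((N : ℝ) ^ 2 * ‖u‖) := by
  have e : (fun k i => ((Real.sqrt (waveSq k) ^ 2 : ℝ) : ℂ) * fc (lowModes N u) k i) =
      trunc N fun k i => ((waveSq k : ℝ) : ℂ) * fc u k i := by
    ext k i
    rw [Real.sq_sqrt (waveSq_nonneg k), fc_lowModes]
    unfold trunc
    split_ifs <;> simp
  rw [stokesPow, e]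
  refine norm_ofFourier_trunc_sq_le fun k hk i => ?_
  rw [norm_mul, Complex.norm_real, Real.norm_of_nonneg (waveSq_nonneg k)]
  exact mul_le_mul hk (norm_fc_le_norm u k i) (norm_nonneg _) (by positivity)

/-- Coefficients are bounded by the `L¹` norm, so `H¹` control of `v` suffices. This matters because
`u_n` is only known to be in `H¹` at every time. -/
lemma norm_fc_advect_le (u : L2) {v : L2} (hv : Sob 1 v) (k : Wave) (i : Fin 2) :
    ‖fc (advect u v) k i‖ ≤ ‖u‖ ^ 2 + ‖stokesPow 1 v‖ ^ 2 := by
  refine (norm_sc_le _ k).trans ?_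
  have hp : ((2 * Real.pi) ^ 2)⁻¹ ≤ 1 :=
    inv_le_one_of_one_le₀ (one_le_pow₀ (by linarith [Real.pi_gt_three]))
  refine (mul_le_of_le_one_left (integral_nonneg fun x => norm_nonneg _) hp).trans ?_
  have hi := fun z : L2 => integrable_sq_add_sq z
  have hi2 : Integrable fun x => (partialD 0 v x 0 ^ 2 + partialD 0 v x 1 ^ 2) +
      (partialD 1 v x 0 ^ 2 + partialD 1 v x 1 ^ 2) := (hi _).add (hi _)
  rw [← norm_partialD_sq_add hv, ← integral_sq_add_sq, ← integral_sq_add_sq, ← integral_sq_add_sq,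
    ← integral_add (hi (partialD 0 v)) (hi (partialD 1 v)),
    ← integral_add (hi u) hi2]
  refine integral_mono_of_nonneg (Eventually.of_forall fun x => norm_nonneg _)
    ((hi u).add hi2) (Eventually.of_forall fun x => ?_)
  simp only [Complex.norm_real, Real.norm_eq_abs, advect_apply]
  have h1 : partialD 0 v x i ^ 2 ≤ partialD 0 v x 0 ^ 2 + partialD 0 v x 1 ^ 2 := by
    fin_cases i <;> simp <;> positivity
  have h2 : partialD 1 v x i ^ 2 ≤ partialD 1 v x 0 ^ 2 + partialD 1 v x 1 ^ 2 := by
    fin_cases i <;> simp <;> positivity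
  rw [abs_le]
  constructor <;>
    nlinarith [sq_nonneg (u x 0 + partialD 0 v x i), sq_nonneg (u x 1 + partialD 1 v x i),
      sq_nonneg (u x 0 - partialD 0 v x i), sq_nonneg (u x 1 - partialD 1 v x i),
      sq_nonneg (u x 0), sq_nonneg (u x 1), sq_nonneg (partialD 0 v x i),
      sq_nonneg (partialD 1 v x i)]

lemma norm_lerayCoeffs_advect_le (u : L2) {v : L2} (hv : Sob 1 v) (k : Wave) (i : Fin 2) :
    ‖lerayCoeffs (fc (advect u v)) k i‖ ≤ 4 * (‖u‖ ^ 2 + ‖stokesPow 1 v‖ ^ 2) := by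
  linarith [norm_lerayCoeffs_le (fc (advect u v)) k i, norm_fc_advect_le u hv k 0,
    norm_fc_advect_le u hv k 1]

lemma norm_lowB_sq_le (N : ℕ) (u : L2) {v : L2} (hv : Sob 1 v) :
    ‖lowB N u v‖ ^ 2 ≤ polyBound N (4 * (‖u‖ ^ 2 + ‖stokesPow 1 v‖ ^ 2)) :=
  norm_ofFourier_trunc_sq_le fun k _ i => norm_lerayCoeffs_advect_le u hv k i

lemma polyBound_mono {K L : ℝ} (hK : 0 ≤ K) (h : K ≤ L) : polyBound N K ≤ polyBound N L := by
  unfold polyBound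
  gcongr

lemma fc_recon (N : ℕ) (u v : L2) (k : Wave) (i : Fin 2) :
    fc (recon N u v) k i = if waveSq k ≤ (N : ℝ) ^ 2 then fc u k i else fc v k i := by
  rw [recon, fc_add, fc_sub, fc_lowModes, fc_lowModes]
  unfold trunc
  split_ifs <;> simp

lemma modeSq_recon_le (N : ℕ) (u v : L2) (k : Wave) :
    modeSq (recon N u v) k ≤ modeSq u k + modeSq v k := by
  have hu := modeSq_nonneg u k
  have hv := modeSq_nonneg v k
  by_cases hk : waveSq k ≤ (N : ℝ) ^ 2
  · have : modeSq (recon N u v) k = modeSq u k := by simp only [modeSq, fc_recon, if_pos hk]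
    linarith
  · have : modeSq (recon N u v) k = modeSq v k := by simp only [modeSq, fc_recon, if_neg hk]
    linarith

lemma sob_recon {m : ℕ} {u v : L2} (hu : Sob m u) (hv : Sob m v) : Sob m (recon N u v) := by
  refine (Summable.add hu hv).of_nonneg_of_le
    (fun k => mul_nonneg (pow_nonneg (waveSq_nonneg k) _) (modeSq_nonneg _ _)) fun k => ?_
  rw [← mul_add]
  exact mul_le_mul_of_nonneg_left (modeSq_recon_le N u v k) (pow_nonneg (waveSq_nonneg k) _)

lemma norm_recon_sq_le (u v : L2) : ‖recon N u v‖ ^ 2 ≤ ‖u‖ ^ 2 + ‖v‖ ^ 2 :=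
  hasSum_le (modeSq_recon_le N u v) (hasSum_modeSq _) ((hasSum_modeSq u).add (hasSum_modeSq v))

lemma norm_stokesPow_recon_sq_le {m : ℕ} {u v : L2} (hu : Sob m u) (hv : Sob m v) :
    ‖stokesPow m (recon N u v)‖ ^ 2 ≤ ‖stokesPow m u‖ ^ 2 + ‖stokesPow m v‖ ^ 2 := by
  refine hasSum_le (fun k => ?_) (hasSum_stokesPow (sob_recon hu hv))
    ((hasSum_stokesPow hu).add (hasSum_stokesPow hv))
  rw [← mul_add]
  exact mul_le_mul_of_nonneg_left (modeSq_recon_le N u v k) (pow_nonneg (waveSq_nonneg k) _)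

/-- Hence the time derivative in the update of the force involves the reference flow alone, and no
time regularity of `v` is needed. -/
lemma lowModes_recon (u v : L2) : lowModes N (recon N u v) = lowModes N u := by
  apply ext_fc
  intro k i
  simp only [fc_lowModes, trunc, fc_recon]
  split_ifs <;> rfl

/-- Poincaré's inequality for mean-free fields. -/
lemma norm_le_norm_stokesPow_one {u : L2} (hu : Sob 1 u) (hσ : u ∈ Lσ) :
    ‖u‖ ^ 2 ≤ ‖stokesPow 1 u‖ ^ 2 := by
  refine hasSum_le (fun k => ?_) (hasSum_modeSq u) (hasSum_stokesPow hu)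
  by_cases hk : k = 0
  · subst hk
    simp [modeSq, hσ.1]
  · rw [pow_one]
    exact le_mul_of_one_le_left (modeSq_nonneg u k) (one_le_waveSq hk)

end LowModes

/-! ### Estimates along the flow: absorbing ball, synchronisation, bounded reconstructed forces. -/

lemma norm_le_supNorm {a : ℝ} {g : ℝ → L2} (h : BddOn a g) {t : ℝ} (ht : a ≤ t) :
    ‖g t‖ ≤ supNorm a g :=
  le_ciSup h (⟨t, ht⟩ : Ici a)

lemma supNorm_nonneg (a : ℝ) (g : ℝ → L2) : 0 ≤ supNorm a g :=
  Real.iSup_nonneg fun _ => norm_nonneg _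

lemma bddOn_iff {a : ℝ} {g : ℝ → L2} : BddOn a g ↔ ∃ C, ∀ t, a ≤ t → ‖g t‖ ≤ C := by
  constructor
  · rintro ⟨C, hC⟩
    exact ⟨C, fun t ht => hC ⟨⟨t, ht⟩, rfl⟩⟩
  · rintro ⟨C, hC⟩
    refine ⟨C, ?_⟩
    rintro _ ⟨t, rfl⟩
    exact hC t t.2

lemma ae_mem_Ici (a : ℝ) : ∀ᵐ t ∂(volume.restrict (Ici a)), a ≤ t :=
  ae_restrict_mem measurableSet_Ici

lemma shape_nonneg (a : ℝ) (f : ℝ → L2) : 0 ≤ shape a f :=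
  div_nonneg (supNorm_nonneg _ _) (supNorm_nonneg _ _)

lemma grashof_nonneg (ν a : ℝ) (f : ℝ → L2) : 0 ≤ grashof ν a f :=
  div_nonneg (supNorm_nonneg _ _) (sq_nonneg _)

section Estimates

variable {c₂ ν μ t₀ : ℝ} {N : ℕ} {f u : ℝ → L2}

/-- The enstrophy of the reference flow stays in the absorbing ball. -/
lemma IsReference.norm_grad_le (h : IsReference c₂ ν t₀ f u) (hν : 0 < ν) {t : ℝ} (ht : t₀ ≤ t) :
    ‖stokesPow 1 (u t)‖ ≤ ν * grashof ν t₀ f := by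
  obtain ⟨u', hp, he⟩ := h.solution.isPath
  set G := grashof ν t₀ f with hG
  have hG0 : 0 ≤ G := grashof_nonneg _ _ _
  have hsup : supNorm t₀ f = ν ^ 2 * G := by
    rw [hG, grashof]
    field_simp
  have hd : ∀ᵐ τ ∂(volume.restrict (Ici t₀)), 2 * inner ℝ (u' τ) (stokesPow 2 (u τ)) ≤
      -ν * ‖stokesPow 1 (u τ)‖ ^ 2 + ν ^ 3 * G ^ 2 := by
    filter_upwards [hp.sob_two, he, ae_mem_Ici t₀] with τ h1 h2 h3
    refine (enstrophy_rate_le h1 (hp.mem τ h3) hν h2).trans ?_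
    have h4 := norm_le_supNorm h.force_bdd h3
    rw [hsup] at h4
    have : 1 / ν * ‖f τ‖ ^ 2 ≤ 1 / ν * (ν ^ 2 * G) ^ 2 := by gcongr
    have e : 1 / ν * (ν ^ 2 * G) ^ 2 = ν ^ 3 * G ^ 2 := by field_simp
    linarith
  have key := hp.enstrophy_le hν hd ht
  have h0 : ‖stokesPow 1 (u t₀)‖ ^ 2 ≤ (ν * G) ^ 2 :=
    pow_le_pow_left₀ (norm_nonneg _) h.init_H1 2
  -- The equilibrium value of the inequality equals the square of the initial bound, so the convex
  -- combination in `key` never exceeds it.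
  have e : ν ^ 3 * G ^ 2 / ν = (ν * G) ^ 2 := by field_simp
  rw [e] at key
  have h5 := mul_le_mul_of_nonneg_left h0 (Real.exp_nonneg (-ν * (t - t₀)))
  exact (le_abs_self _).trans (abs_le_of_sq_le_sq (by linarith) (by positivity))

/-- Decay of the synchronisation error of the nudged system. -/
lemma IsReference.error_le (h : IsReference c₂ ν t₀ f u) (hν : 0 < ν) (hμ : 0 < μ)
    (hlow : 4 * interpConst * grashof ν t₀ f ^ 3 * ν ≤ μ) (hN : μ ≤ ν * (N : ℝ) ^ 2)
    {a : ℝ} (ha : t₀ ≤ a) {F v : ℝ → L2}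
    (hv : IsStrongSolution ν a (fun s => F s - μ • lowModes N (v s - u s)) v)
    (hb : BddOn a fun s => F s - f s) {t : ℝ} (ht : a ≤ t) :
    ‖stokesPow 1 (v t - u t)‖ ^ 2 ≤ Real.exp (-μ * (t - a)) * ‖stokesPow 1 (v a - u a)‖ ^ 2 +
      4 / ν * supNorm a (fun s => F s - f s) ^ 2 / μ := by
  obtain ⟨u', hp, he⟩ := h.solution.isPath
  obtain ⟨v', hq, hve⟩ := hv.isPath
  have hp' := hp.mono ha
  have he' := ae_mono (Measure.restrict_mono (Ici_subset_Ici.mpr ha) le_rfl) he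
  have hd : ∀ᵐ τ ∂(volume.restrict (Ici a)),
      2 * inner ℝ (v' τ - u' τ) (stokesPow 2 (v τ - u τ)) ≤
      -μ * ‖stokesPow 1 (v τ - u τ)‖ ^ 2 + 4 / ν * supNorm a (fun s => F s - f s) ^ 2 := by
    filter_upwards [hp'.sob_two, hq.sob_two, he', hve, ae_mem_Ici a] with τ h1 h2 h3 h4 h5
    refine (error_rate_le h1 (hp'.mem τ h5) h2 (hq.mem τ h5) (g := F τ - f τ) hν hμ
      (grashof_nonneg ν t₀ f) hN hlow (h.norm_grad_le hν (ha.trans h5)) ?_).trans ?_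
    · rw [stokesPow_sub h2 h1, ← h3, sub_sub, add_comm (u' τ + _ + _), ← sub_sub, ← h4, smul_sub]
      abel
    · gcongr
      exact norm_le_supNorm hb h5
  have key := (hq.sub hp').enstrophy_le hμ hd ht
  refine key.trans ?_
  gcongr
  have hK : 0 ≤ 4 / ν * supNorm a (fun s => F s - f s) ^ 2 / μ := by positivity
  exact mul_le_of_le_one_right hK (by linarith [Real.exp_nonneg (-μ * (t - a))])

/-- The low modes of the reference flow are Lipschitz in time. -/
lemma IsReference.exists_lipschitz (h : IsReference c₂ ν t₀ f u) (hν : 0 < ν) (N : ℕ) :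
    ∃ K, ∀ k, waveSq k ≤ (N : ℝ) ^ 2 → ∀ i s t, t₀ ≤ s → t₀ ≤ t →
      ‖fc (u t) k i - fc (u s) k i‖ ≤ K * |t - s| := by
  obtain ⟨u', hp, he⟩ := h.solution.isPath
  set R := ν * grashof ν t₀ f
  -- The three terms bound the low coefficients of `f`, `νAu` and `B(u,u)` in the equation for `u'`.
  set K := supNorm t₀ f + ν * ((N : ℝ) ^ 2 * R) + 4 * (R ^ 2 + R ^ 2) with hK
  have hgrad : ∀ t, t₀ ≤ t → ‖stokesPow 1 (u t)‖ ≤ R := fun t ht => h.norm_grad_le hν ht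
  have hnorm : ∀ t, t₀ ≤ t → ‖u t‖ ≤ R := fun t ht =>
    ((le_abs_self _).trans (abs_le_of_sq_le_sq (norm_le_norm_stokesPow_one (hp.sob_one t ht)
      (hp.mem t ht)) (norm_nonneg _))).trans (hgrad t ht)
  have hae : ∀ k, waveSq k ≤ (N : ℝ) ^ 2 → ∀ i, ∀ᵐ τ ∂(volume.restrict (Ici t₀)),
      ‖fc (u' τ) k i‖ ≤ K := by
    intro k hk i
    filter_upwards [hp.sob_two, he, ae_mem_Ici t₀] with τ h1 h2 h3
    have e : u' τ = f τ - ν • stokesPow 2 (u τ) - B (u τ) (u τ) := by rw [← h2]; abel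
    rw [e, fc_sub, fc_sub, fc_smul, fc_stokesPow_two h1]
    have b1 : ‖fc (f τ) k i‖ ≤ supNorm t₀ f :=
      (norm_fc_le_norm _ k i).trans (norm_le_supNorm h.force_bdd h3)
    have b2 : ‖(ν : ℂ) * ((waveSq k : ℂ) * fc (u τ) k i)‖ ≤ ν * ((N : ℝ) ^ 2 * R) := by
      rw [norm_mul, norm_mul, Complex.norm_real, Complex.norm_real, Real.norm_of_nonneg hν.le,
        Real.norm_of_nonneg (waveSq_nonneg k)]
      gcongr
      exact (norm_fc_le_norm _ k i).trans (hnorm τ h3)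
    have b3 : ‖fc (B (u τ) (u τ)) k i‖ ≤ 4 * (R ^ 2 + R ^ 2) := by
      unfold B
      rw [fc_leray (memLp_advect _ h1 (hp.mem τ h3).1)]
      refine (norm_lerayCoeffs_advect_le _ (hp.sob_one τ h3) k i).trans ?_
      gcongr
      · exact hnorm τ h3
      · exact hgrad τ h3
    rw [hK]
    exact (norm_sub_le _ _).trans (add_le_add ((norm_sub_le _ _).trans (add_le_add b1 b2)) b3)
  have main : ∀ k, waveSq k ≤ (N : ℝ) ^ 2 → ∀ i s t, t₀ ≤ s → s ≤ t →
      ‖fc (u t) k i - fc (u s) k i‖ ≤ K * |t - s| := by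
    intro k hk i s t hs hst
    rw [hp.fc_eq hs hst, add_sub_cancel_left]
    refine intervalIntegral.norm_integral_le_of_norm_le_const_ae ?_
    have := ae_restrict_Icc (hae k hk i) hs t
    rw [ae_restrict_iff' measurableSet_Icc] at this
    filter_upwards [this] with τ hτ hm
    rw [uIoc_of_le hst] at hm
    exact hτ ⟨hm.1.le, hm.2⟩
  refine ⟨K, fun k hk i s t hs ht => ?_⟩
  rcases le_total s t with hst | hst
  · exact main k hk i s t hs hst
  · rw [norm_sub_rev, abs_sub_comm]
    exact main k hk i t s ht hst

/-- A Lipschitz bound passes to the derivative; the strict `a < s` leaves a full neighbourhood of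
`s` on which it holds. -/
lemma norm_fc_deriv_le {z : ℝ → L2} {D : L2} {s a K : ℝ} (hs : a < s) (hD : HasDerivAt z D s)
    {k : Wave} {i : Fin 2} (hK : 0 ≤ K)
    (hz : ∀ r, a ≤ r → ‖fc (z r) k i - fc (z s) k i‖ ≤ K * |r - s|) : ‖fc D k i‖ ≤ K := by
  have h1 : HasDerivAt (fun r => fc (z r) k i) (fc D k i) s :=
    (fcL k i).hasFDerivAt.comp_hasDerivAt s hD
  refine h1.le_of_lip' hK ?_
  filter_upwards [lt_mem_nhds hs] with r hr
  rw [Real.norm_eq_abs]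
  exact hz r hr.le

/-- The reconstructed forces are bounded. -/
lemma IsReference.bddOn_error (h : IsReference c₂ ν t₀ f u) (hν : 0 < ν) (hμ : 0 < μ)
    (hlow : 4 * interpConst * grashof ν t₀ f ^ 3 * ν ≤ μ) (hN : μ ≤ ν * (N : ℝ) ^ 2)
    {m : ℕ} {t : ℕ → ℝ} {F v : ℕ → ℝ → L2} (hr : IsRun ν μ N t₀ u m t F v) :
    ∀ k, k ≤ m → t₀ ≤ t k ∧ BddOn (t k) fun s => F k s - f s := by
  obtain ⟨Cf, hCf⟩ := bddOn_iff.mp h.force_bdd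
  intro k
  induction k with
  | zero =>
    intro _
    rw [hr.time_zero]
    obtain ⟨C, hC⟩ := bddOn_iff.mp hr.guess_bdd
    exact ⟨le_rfl, bddOn_iff.mpr ⟨C + Cf, fun s hs =>
      (norm_sub_le _ _).trans (add_le_add (hC s hs) (hCf s hs))⟩⟩
  | succ k ih =>
    intro hk
    obtain ⟨ht0, hb⟩ := ih (by omega)
    have htk := hr.time_lt k (by omega)
    refine ⟨ht0.trans htk.le, ?_⟩
    have hnud := hr.nudged k (by omega)
    obtain ⟨K, hK⟩ := h.exists_lipschitz hν N
    obtain ⟨u', hpu, -⟩ := h.solution.isPath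
    obtain ⟨v', hpv, -⟩ := hnud.isPath
    set R := ν * grashof ν t₀ f
    set Y := ‖stokesPow 1 (v (k + 1) (t k) - u (t k))‖ ^ 2 +
      4 / ν * supNorm (t k) (fun s => F k s - f s) ^ 2 / μ with hY
    have hu1 : ∀ s, t k ≤ s → ‖stokesPow 1 (u s)‖ ^ 2 ≤ R ^ 2 := fun s hs =>
      pow_le_pow_left₀ (norm_nonneg _) (h.norm_grad_le hν (ht0.trans hs)) 2
    have hv1 : ∀ s, t k ≤ s → ‖stokesPow 1 (v (k + 1) s)‖ ^ 2 ≤ 2 * Y + 2 * R ^ 2 := by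
      intro s hs
      have h1 := h.error_le hν hμ hlow hN ht0 hnud hb hs
      have h2 : Real.exp (-μ * (s - t k)) ≤ 1 := by
        rw [Real.exp_le_one_iff]
        nlinarith
      have h3 := mul_le_of_le_one_left
        (sq_nonneg ‖stokesPow 1 (v (k + 1) (t k) - u (t k))‖) h2
      rw [stokesPow_sub (hpv.sob_one s hs) (hpu.sob_one s (ht0.trans hs))] at h1
      set x := stokesPow 1 (v (k + 1) s)
      set y := stokesPow 1 (u s) with hy
      have h4 : ‖x‖ ≤ ‖x - y‖ + ‖y‖ := by simpa using norm_add_le (x - y) y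
      have h5 := hu1 s hs
      rw [← hy] at h5
      have h6 : ‖x‖ ^ 2 ≤ (‖x - y‖ + ‖y‖) ^ 2 := pow_le_pow_left₀ (norm_nonneg _) h4 2
      nlinarith [sq_nonneg (‖x - y‖ - ‖y‖)]
    set L := R ^ 2 + (2 * Y + 2 * R ^ 2) with hL
    have hsσ : ∀ s, t k ≤ s → ‖recon N (u s) (v (k + 1) s)‖ ^ 2 ≤ L ∧
        Sob 1 (recon N (u s) (v (k + 1) s)) ∧
        ‖stokesPow 1 (recon N (u s) (v (k + 1) s))‖ ^ 2 ≤ L := by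
      intro s hs
      have su := hpu.sob_one s (ht0.trans hs)
      have sv := hpv.sob_one s hs
      have hn := add_le_add (hu1 s hs) (hv1 s hs)
      exact ⟨(norm_recon_sq_le _ _).trans ((add_le_add
        (norm_le_norm_stokesPow_one su (hpu.mem s (ht0.trans hs)))
        (norm_le_norm_stokesPow_one sv (hpv.mem s hs))).trans hn), sob_recon su sv,
        (norm_stokesPow_recon_sq_le su sv).trans hn⟩
    have hsqrt : ∀ {x : L2} {b : ℝ}, ‖x‖ ^ 2 ≤ b → ‖x‖ ≤ Real.sqrt b := fun hx =>
      Real.le_sqrt_of_sq_le hx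
    -- The four terms bound `d/dt P_N u`, `ν A P_N u_n`, `P_N B(u_n,u_n)` and `f`. The sign of `K`
    -- is not part of `exists_lipschitz`, hence `|K|`.
    refine bddOn_iff.mpr ⟨Real.sqrt (polyBound N |K|) +
      ν * Real.sqrt (polyBound N ((N : ℝ) ^ 2 * Real.sqrt L)) +
      Real.sqrt (polyBound N (4 * (L + L))) + Cf, fun s hs => ?_⟩
    have hks : t k ≤ s := htk.le.trans hs
    obtain ⟨b1, b2, b3⟩ := hsσ s hks
    have hD := hr.update k (by omega) s hs
    simp only [lowModes_recon] at hD
    set x := recon N (u s) (v (k + 1) s)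
    set D := F (k + 1) s - ν • stokesPow 2 (lowModes N (u s)) - lowB N x x with hDdef
    have hD1 : ‖D‖ ^ 2 ≤ polyBound N |K| := by
      refine norm_sq_le_of_fc (fun p hp i => ?_) fun p hp i => ?_
      · refine norm_fc_deriv_le (a := t₀) (ht0.trans_lt (htk.trans_le hs)) hD (abs_nonneg K)
          fun r hr => ?_
        simp only [fc_lowModes, trunc, if_pos hp]
        refine (hK p hp i s r (ht0.trans hks) hr).trans ?_
        gcongr
        exact le_abs_self K
      -- Above `N` the coefficients of `P_N u` are constantly `0`, so the Lipschitz constant `0`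
      -- applies.
      · rw [← norm_le_zero_iff]
        refine norm_fc_deriv_le (a := t₀) (ht0.trans_lt (htk.trans_le hs)) hD le_rfl
          fun r hr => ?_
        simp [fc_lowModes, trunc, if_neg hp]
    have e : F (k + 1) s - f s =
        D + ν • stokesPow 2 (lowModes N x) + lowB N x x - f s := by
      rw [hDdef, lowModes_recon]
      abel
    rw [e]
    refine (norm_sub_le _ _).trans (add_le_add ((norm_add_le _ _).trans
      (add_le_add ((norm_add_le _ _).trans (add_le_add (hsqrt hD1) ?_)) ?_))
      (hCf s (ht0.trans hks)))
    · rw [norm_smul, Real.norm_of_nonneg hν.le]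
      gcongr
      refine hsqrt ((norm_stokesPow_lowModes_sq_le x).trans (polyBound_mono (by positivity) ?_))
      gcongr
      exact hsqrt b1
    · refine hsqrt ((norm_lowB_sq_le N x b2).trans (polyBound_mono (by positivity) ?_))
      gcongr

/-- Past the relaxation period the initial error is below the level of the model error. -/
lemma exp_mul_sq_le {C₁ ν μ ρ S y τ : ℝ} (hC : 0 < C₁) (hν : 0 < ν) (hμ : 0 < μ) (hS : 0 < S)
    (hy : 0 ≤ y) (hρ : 1 / μ * Real.log (μ / (C₁ * ν) * (ν * y / S) ^ 2) ≤ ρ) (hτ : ρ ≤ τ) :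
    Real.exp (-μ * τ) * y ^ 2 ≤ C₁ * S ^ 2 / (μ * ν) := by
  -- For `y = 0` the hypothesis reads `0 ≤ ρ`, since `Real.log 0 = 0`, and the left side vanishes.
  rcases hy.eq_or_lt with rfl | hy
  · simp; positivity
  have hX : 0 < μ / (C₁ * ν) * (ν * y / S) ^ 2 := by positivity
  have h1 : Real.log (μ / (C₁ * ν) * (ν * y / S) ^ 2) ≤ μ * τ := by
    rw [one_div, inv_mul_le_iff₀ hμ] at hρ
    exact hρ.trans (by gcongr)
  have h2 := (Real.log_le_iff_le_exp hX).mp h1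
  rw [neg_mul, Real.exp_neg, inv_mul_le_iff₀ (Real.exp_pos _)]
  have e : y ^ 2 = μ / (C₁ * ν) * (ν * y / S) ^ 2 * (C₁ * S ^ 2 / (μ * ν)) := by
    field_simp
  rw [e]
  gcongr

end Estimates

end Nudging

end

/-! ### The proposition. -/

open Nudging in
theorem proposition6p1 :
    ∃ cUp C₁ : ℝ, 1 ≤ cUp ∧ 1 ≤ C₁ ∧
    ∀ c₂ : ℝ, 0 < c₂ → ∃ cLow : ℝ, 1 ≤ cLow ∧
    ∀ (ν μ t₀ : ℝ) (N : ℕ) (f u : ℝ → L2),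
      0 < ν → 0 < μ → 0 ≤ t₀ →
      IsReference c₂ ν t₀ f u →
      cLow * (shape t₀ f + grashof ν t₀ f) * grashof ν t₀ f ^ 2 ≤ μ / ν →
      μ / ν ≤ cUp * (N : ℝ) ^ 2 →
      -- the stage `n = m + 1`
      ∀ (m : ℕ) (t : ℕ → ℝ) (F v : ℕ → ℝ → L2),
        IsRun ν μ N t₀ u m t F v →
        -- the previous model error `F m - f` is bounded on `[t m, ∞)`
        BddOn (t m) (fun s => F m s - f s) ∧
        -- the estimate, when the previous model error does not vanish identically
        ((∃ s, t m ≤ s ∧ F m s ≠ f s) →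
          (∃ ρ : ℝ, 0 < ρ ∧
            relaxBound C₁ ν μ (t m) (fun s => F m s - f s) (fun s => v (m + 1) s - u s) ≤ ρ ∧
            ∀ s, t m + ρ ≤ s →
              ‖stokesPow 1 (v (m + 1) s - u s)‖ / ν ≤
                Real.sqrt (2 * C₁ * ν / μ) * (supNorm (t m) (fun s => F m s - f s) / ν ^ 2)) ∧
          (∀ ρ : ℝ, 0 < ρ →
            relaxBound C₁ ν μ (t m) (fun s => F m s - f s) (fun s => v (m + 1) s - u s) ≤ ρ →
            ∀ s, t m + ρ ≤ s →
              ‖stokesPow 1 (v (m + 1) s - u s)‖ / ν ≤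
                Real.sqrt (2 * C₁ * ν / μ) * (supNorm (t m) (fun s => F m s - f s) / ν ^ 2))) := by
  -- `cUp = 1` gives `μ ≤ νN²`; `C₁ = 4` is the factor of `‖g‖²/ν` in `error_rate_le`; `cLow` lets
  -- the threshold dominate `4 * interpConst * G³`.
  refine ⟨1, 4, le_rfl, by norm_num, fun c₂ _ => ⟨max 1 (4 * interpConst), le_max_left _ _, ?_⟩⟩
  intro ν μ t₀ N f u hν hμ _ hf hlow hup m t F v hr
  have hG := grashof_nonneg ν t₀ f
  have hsh := shape_nonneg t₀ f
  have hN : μ ≤ ν * (N : ℝ) ^ 2 := by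
    rw [div_le_iff₀ hν] at hup
    linarith
  have hlow' : 4 * interpConst * grashof ν t₀ f ^ 3 * ν ≤ μ := by
    rw [le_div_iff₀ hν] at hlow
    refine le_trans ?_ hlow
    have h1 : 4 * interpConst * grashof ν t₀ f ≤
        max 1 (4 * interpConst) * (shape t₀ f + grashof ν t₀ f) :=
      mul_le_mul (le_max_right _ _) (by linarith) hG (by positivity)
    calc 4 * interpConst * grashof ν t₀ f ^ 3 * ν
        = (4 * interpConst * grashof ν t₀ f) * grashof ν t₀ f ^ 2 * ν := by ring
      _ ≤ _ := by gcongr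
  obtain ⟨ht0, hb⟩ := hf.bddOn_error hν hμ hlow' hN hr m le_rfl
  refine ⟨hb, fun ⟨s₀, hs₀, hne⟩ => ?_⟩
  have hS : 0 < supNorm (t m) (fun s => F m s - f s) :=
    (norm_pos_iff.mpr (sub_ne_zero.mpr hne)).trans_le (norm_le_supNorm hb hs₀)
  have main : ∀ ρ : ℝ, 0 < ρ →
      relaxBound 4 ν μ (t m) (fun s => F m s - f s) (fun s => v (m + 1) s - u s) ≤ ρ →
      ∀ s, t m + ρ ≤ s →
        ‖stokesPow 1 (v (m + 1) s - u s)‖ / ν ≤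
          Real.sqrt (2 * 4 * ν / μ) * (supNorm (t m) (fun s => F m s - f s) / ν ^ 2) := by
    intro ρ hρ hrel s hs
    have h1 := hf.error_le hν hμ hlow' hN ht0 (hr.nudged m le_rfl) hb (t := s) (by linarith)
    have h2 := exp_mul_sq_le (by norm_num) hν hμ hS (norm_nonneg _) hrel
      (show ρ ≤ s - t m by linarith)
    set S := supNorm (t m) (fun s => F m s - f s)
    set y := ‖stokesPow 1 (v (m + 1) s - u s)‖
    -- The decayed initial error and the forcing each contribute `4S²/(μν)`, whence the factor `2
    -- C₁`.
    have h3 : y ^ 2 ≤ 8 * S ^ 2 / (μ * ν) := by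
      refine (h1.trans (add_le_add_left h2 _)).trans_eq ?_
      field_simp
      norm_num
    refine (le_abs_self _).trans (abs_le_of_sq_le_sq ?_ (by positivity))
    rw [mul_pow, Real.sq_sqrt (by positivity), div_pow, div_pow]
    calc y ^ 2 / ν ^ 2 ≤ 8 * S ^ 2 / (μ * ν) / ν ^ 2 := by gcongr
      _ = _ := by field_simp; norm_num
  refine ⟨?_, main⟩
  set b := relaxBound 4 ν μ (t m) (fun s => F m s - f s) (fun s => v (m + 1) s - u s)
  -- The logarithmic bound `b` may be negative, while a relaxation period must be positive.
  have hpos : 0 < max b 1 := lt_of_lt_of_le one_pos (le_max_right _ _)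
  exact ⟨max b 1, hpos, le_max_left _ _, main _ hpos (le_max_left _ _)⟩
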